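/- All groups are finite. For a group $G$ let $\mathrm{Irr}(G)$ be the set of irreducible complex characters of $G$. For $\chi\in\mathrm{Irr}(G)$ put $\ker\chi=\{g\in G:\chi(g)=\chi(1)\}$ and $Z(\chi)=\{g\in G:|\chi(g)|=\chi(1)\}$. We say that $\chi$ has central type if $\chi(g)=0$ for every $g\in G\setminus Z(\chi)$, and that $G$ is a GVZ-group if every $\chi\in\mathrm{Irr}(G)$ has central type. For a normal subgroup $N$ of $G$ let $\mathrm{Irr}(G\mid N)$ be the set of those $\chi\in\mathrm{Irr}(G)$ with $N\nleq\ker\chi$. Theorem. Let $N$ be a normal subgroup of a finite group $G$. For a Sylow subgroup $S$ of $G$ (for some prime), let $(*)_S$ be the condition: there is a subgroup $Q$ of $G$ such that $G=S\times Q$ (internal direct product) and $Q$ is a GVZ-group, and all characters in $\mathrm{Irr}(S\mid S\cap N)$ have central type. (1) All characters in $\mathrm{Irr}(G\mid N)$ have central type if and only if $(*)_S$ holds for every Sylow subgroup $S$ of $G$ that intersects $N$ nontrivially. (2) If $N\neq 1$ and all characters in $\mathrm{Irr}(G\mid N)$ have central type, then there is a Sylow subgroup $S$ of $G$ with $S\cap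 N\neq 1$ for which $(*)_S$ holds. (3) If $N\ne 1$ is a $p$-group for some prime $p$, then all characters in $\mathrm{Irr}(G\mid N)$ have central type if and only if there is a Sylow subgroup $S$ of $G$ with $S\cap N\neq 1$ for which $(*)_S$ holds. (4) If $p$ is a prime, $N\neq 1$ is a $p$-group and all characters in $\mathrm{Irr}(G\mid N)$ have central type, then $G$ has a unique Hall $p$-complement (a subgroup of order prime to $p$ and of $p$-power index); it is normal in $G$ and it is a GVZ-group. -/

import Mathlib

/-- The set `Irr G` of irreducible complex characters of `G`, as functions `G → ℂ`. Every
finite-dimensional complex representation is isomorphic to one on some `ℂ ^ n`; irreducible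
representations are nonzero. -/
def Irr (G : Type*) [Group G] : Set (G → ℂ) :=
  {χ | ∃ (n : ℕ) (ρ : Representation ℂ G (Fin n → ℂ)), ρ.IsIrreducible ∧ χ = ρ.character}

/-- The kernel of a character. -/
def charKernel {G : Type*} [Group G] (χ : G → ℂ) : Set G :=
  {g | χ g = χ 1}

/-- The center `Z(χ)` of a character: the elements `g` with `|χ(g)| = χ(1)`. -/
def charCenter {G : Type*} [Group G] (χ : G → ℂ) : Set G :=
  {g | ((‖χ g‖ : ℝ) : ℂ) = χ 1}

/-- The set `Irr(G | N)` of irreducible characters of `G` whose kernel does not contain `N`. -/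
def IrrOver (G : Type*) [Group G] (N : Subgroup G) : Set (G → ℂ) :=
  {χ | χ ∈ Irr G ∧ ¬ ((N : Set G) ⊆ charKernel χ)}

/-- A character has central type if it vanishes off its center. -/
def HasCentralType {G : Type*} [Group G] (χ : G → ℂ) : Prop :=
  ∀ g : G, g ∉ charCenter χ → χ g = 0

/-- A GVZ-group: every irreducible character has central type. -/
def IsGVZGroup (G : Type*) [Group G] : Prop :=
  ∀ χ ∈ Irr G, HasCentralType χ

/-- `G = S × Q` as an internal direct product of the subgroups `S` and `Q`. -/
def IsInternalDirectProduct {G : Type*} [Group G] (S Q : Subgroup G) : Prop :=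
  S.Normal ∧ Q.Normal ∧ S ⊓ Q = ⊥ ∧ S ⊔ Q = ⊤

/-- `Q` is a Hall `p`-complement of the finite group `G`. -/
def IsHallPComplement {G : Type*} [Group G] (p : ℕ) (Q : Subgroup G) : Prop :=
  ¬ p ∣ Nat.card Q ∧ ∃ k : ℕ, Q.index = p ^ k

/-- `G = S × Q` for some GVZ-group `Q`, and all characters in `Irr(S | S ∩ N)` have central
type. -/
def HasGVZComplementDecomposition {G : Type*} [Group G] (S N : Subgroup G) : Prop :=
  (∃ Q : Subgroup G, IsInternalDirectProduct S Q ∧ IsGVZGroup Q) ∧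
    ∀ θ ∈ IrrOver S (N.subgroupOf S), HasCentralType θ

/-! Write `[g, G]` for the normal closure of the commutators of `g`, and `Σ` for the class sum of
`g`. An irreducible representation that is scalar at `g` kills `[g, G]`; one whose character
vanishes at `g` kills `Σ`. So if all characters over `N` have central type, then `(1 - m) Σ` for `m
∈ N ∩ [g, G]`, and `(1 - m)(1 - k) Σ` for `m ∈ N` and `k ∈ [g, G]`, act as zero in every irreducible
representation and hence vanish in `ℂ[G]`. Comparing coefficients, `g` is conjugate to `m * g` in
the first case, and to every `k * g` in the second if `N ≠ 1` meets `[g, G]` trivially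
(`isConj_mul_of_le_elementCommutator`, `isConj_mul_of_inf_eq_bot`).

Call `x` flat if it is conjugate to all of `[x, G] x`. A flat `x ≠ 1` lies outside `[x, G]`, so
minimizing `[x, G]` produces central elements. In `N`, where all elements are flat, this gives a
central `z` of order `p` for each prime `p` dividing `|N|`. Comparing coprime orders and inducting
on `|G|`, `p`-elements then commute with `p'`-elements (`commute_of_centralType_over_central`), so
`G = S × Q` with `S` a Sylow `p`-subgroup.

For a direct product, `χ(sq) χ(1) = χ(s) χ(q)`, and `χ` is proportional to an irreducible character
on each factor; central type and kernels thus pass between `G` and the factors. For the converse, a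
character nontrivial on `N` is nontrivial on some `S ∩ N` with `S` Sylow. -/

open scoped MonoidAlgebra

/-! ### Irreducible representations and Schur's lemma -/

/-- Intertwining linear equivalences transport irreducibility. -/
theorem Representation.IsIrreducible.of_linearEquiv {G V W : Type*} [Group G]
    [AddCommGroup V] [Module ℂ V] [AddCommGroup W] [Module ℂ W]
    {ρ : Representation ℂ G V} {σ : Representation ℂ G W} (hρ : ρ.IsIrreducible)
    (e : V ≃ₗ[ℂ] W) (he : ∀ g v, e (ρ g v) = σ g (e v)) : σ.IsIrreducible := by
  let f : Subrepresentation σ ≃o Subrepresentation ρ :=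
    { toFun := fun U => ⟨U.toSubmodule.comap e.toLinearMap, fun g v hv => by
        simp only [Submodule.mem_comap, LinearEquiv.coe_coe, he] at hv ⊢
        exact U.apply_mem_toSubmodule g hv⟩
      invFun := fun U => ⟨U.toSubmodule.comap e.symm.toLinearMap, fun g v hv => by
        simp only [Submodule.mem_comap, LinearEquiv.coe_coe] at hv ⊢
        have := U.apply_mem_toSubmodule g hv
        rwa [show e.symm (σ g v) = ρ g (e.symm v) by
          rw [LinearEquiv.symm_apply_eq, he, LinearEquiv.apply_symm_apply]]⟩
      left_inv := fun U => by
        ext v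
        simp
      right_inv := fun U => by
        ext v
        simp
      map_rel_iff' := fun {U U'} => by
        constructor
        · intro h v hv
          have := @h (e.symm v) (by
            change e (e.symm v) ∈ U.toSubmodule
            rw [LinearEquiv.apply_symm_apply]; exact hv)
          change e (e.symm v) ∈ U'.toSubmodule at this
          rwa [LinearEquiv.apply_symm_apply] at this
        · intro h v hv
          exact h hv }
  exact (OrderIso.isSimpleOrder_iff f).mpr hρ

theorem Representation.IsIrreducible.nontrivial_space {G V : Type*} [Group G]
    [AddCommGroup V] [Module ℂ V] {ρ : Representation ℂ G V} (hρ : ρ.IsIrreducible) :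
    Nontrivial V := by
  have := hρ
  by_contra h
  rw [not_nontrivial_iff_subsingleton] at h
  obtain ⟨a, b, hab⟩ := hρ.toNontrivial
  exact hab (Subrepresentation.toSubmodule_injective (Subsingleton.elim _ _))

/-- The representation transported along a linear equivalence. -/
def Representation.transport {G V W : Type*} [Group G]
    [AddCommGroup V] [Module ℂ V] [AddCommGroup W] [Module ℂ W]
    (ρ : Representation ℂ G V) (e : V ≃ₗ[ℂ] W) : Representation ℂ G W where
  toFun g := e.conj (ρ g)
  map_one' := by ext; simp [LinearEquiv.conj_apply]
  map_mul' a b := by ext; simp [LinearEquiv.conj_apply]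

theorem Representation.character_transport {G V W : Type*} [Group G]
    [AddCommGroup V] [Module ℂ V] [AddCommGroup W] [Module ℂ W]
    (ρ : Representation ℂ G V) (e : V ≃ₗ[ℂ] W) :
    (ρ.transport e).character = ρ.character := by
  ext g
  exact LinearMap.trace_conj' (ρ g) e

theorem Representation.IsIrreducible.transport {G V W : Type*} [Group G]
    [AddCommGroup V] [Module ℂ V] [AddCommGroup W] [Module ℂ W]
    {ρ : Representation ℂ G V} (hρ : ρ.IsIrreducible) (e : V ≃ₗ[ℂ] W) :
    (ρ.transport e).IsIrreducible :=
  hρ.of_linearEquiv e fun g v => by simp [Representation.transport, LinearEquiv.conj_apply]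

theorem character_mem_Irr {G V : Type*} [Group G] [AddCommGroup V] [Module ℂ V]
    [FiniteDimensional ℂ V] {ρ : Representation ℂ G V} (hρ : ρ.IsIrreducible) :
    ρ.character ∈ Irr G :=
  ⟨_, ρ.transport (Module.finBasis ℂ V).equivFun, hρ.transport _,
    (ρ.character_transport _).symm⟩

theorem Representation.exists_irreducible_subrepresentation {G V : Type*} [Group G]
    [AddCommGroup V] [Module ℂ V] [FiniteDimensional ℂ V] [Nontrivial V]
    (ρ : Representation ℂ G V) :
    ∃ U : Subrepresentation ρ, U.toRepresentation.IsIrreducible := by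
  classical
  -- A nonzero subrepresentation of least dimension is irreducible.
  obtain ⟨U, hU, hmin⟩ := WellFounded.has_min
    (InvImage.wf (fun U : Subrepresentation ρ => Module.finrank ℂ U.toSubmodule) wellFounded_lt)
    {U | U.toSubmodule ≠ ⊥} ⟨⊤, (top_ne_bot : (⊤ : Submodule ℂ V) ≠ ⊥)⟩
  have hnt : Nontrivial U.toSubmodule := Submodule.nontrivial_iff_ne_bot.mpr hU
  have hnt' : Nontrivial (Subrepresentation U.toRepresentation) :=
    ⟨⊥, ⊤, fun h => bot_ne_top (α := Submodule ℂ U.toSubmodule)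
      (congrArg Subrepresentation.toSubmodule h)⟩
  refine ⟨U, ⟨?_⟩⟩
  · intro W
    let W' : Subrepresentation ρ := ⟨W.toSubmodule.map U.toSubmodule.subtype, by
      rintro g _ ⟨w, hw, rfl⟩
      exact ⟨_, W.apply_mem_toSubmodule g hw, rfl⟩⟩
    by_cases hW : W.toSubmodule = ⊥
    · exact Or.inl (Subrepresentation.toSubmodule_injective hW)
    · right
      have h1 : ¬ _ < _ := hmin W' (by
        change W.toSubmodule.map U.toSubmodule.subtype ≠ ⊥
        exact fun h => hW (Submodule.map_injective_of_injective
          (Submodule.injective_subtype _) (h.trans (Submodule.map_bot _).symm)))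
      have h2 : Module.finrank ℂ W'.toSubmodule = Module.finrank ℂ W.toSubmodule :=
        
        (Submodule.equivMapOfInjective _ (Submodule.injective_subtype _) _).finrank_eq.symm
      refine Subrepresentation.toSubmodule_injective ?_
      apply Submodule.eq_top_of_finrank_eq
      have h3 := Submodule.finrank_le W.toSubmodule
      rw [← h2] at h3 ⊢
      exact le_antisymm h3 (not_lt.mp h1)

theorem Representation.IsIrreducible.exists_eq_smul_one {G V : Type*} [Group G]
    [AddCommGroup V] [Module ℂ V] [FiniteDimensional ℂ V] {ρ : Representation ℂ G V}
    (hρ : ρ.IsIrreducible) (T : Module.End ℂ V) (hT : ∀ g, T * ρ g = ρ g * T) :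
    ∃ c : ℂ, T = c • 1 := by
  have := hρ.nontrivial_space
  obtain ⟨c, hc⟩ := Module.End.exists_eigenvalue T
  let U : Subrepresentation ρ := ⟨Module.End.eigenspace T c, fun g v hv => by
    rw [Module.End.mem_eigenspace_iff] at hv ⊢
    have := congrArg (fun f => f v) (hT g)
    simp only [Module.End.mul_apply] at this
    rw [this, hv, map_smul]⟩
  refine ⟨c, ?_⟩
  rcases hρ.eq_bot_or_eq_top U with h | h
  · exact absurd (congrArg Subrepresentation.toSubmodule h) hc
  · ext v
    have : v ∈ U.toSubmodule := by rw [h]; trivial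
    simpa using Module.End.mem_eigenspace_iff.mp this

/-- The sum commutes with the action, so Schur's lemma makes it scalar; its trace determines the
scalar. -/
theorem Representation.IsIrreducible.sum_conj_eq {G V : Type*} [Group G] [Fintype G]
    [AddCommGroup V] [Module ℂ V] [FiniteDimensional ℂ V] {ρ : Representation ℂ G V}
    (hρ : ρ.IsIrreducible) (g : G) :
    ∑ x, ρ (x * g * x⁻¹) = (Fintype.card G * ρ.character g / ρ.character 1) • 1 := by
  have := hρ.nontrivial_space
  obtain ⟨c, hc⟩ := hρ.exists_eq_smul_one (∑ x, ρ (x * g * x⁻¹)) fun h => by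
    rw [Finset.sum_mul, Finset.mul_sum]
    refine Fintype.sum_equiv (Equiv.mulLeft h⁻¹) _ _ fun x => ?_
    rw [← map_mul, ← map_mul]
    congr 1
    simp [mul_assoc]
  have h := congrArg (LinearMap.trace ℂ V) hc
  have h0 : (Module.finrank ℂ V : ℂ) ≠ 0 := by
    exact_mod_cast (Module.finrank_pos (R := ℂ) (M := V)).ne'
  have h1 : ∑ x, LinearMap.trace ℂ V (ρ (x * g * x⁻¹)) = Fintype.card G * ρ.character g := by
    have h2 (x : G) : LinearMap.trace ℂ V (ρ (x * g * x⁻¹)) = ρ.character g := ρ.char_conj g x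
    rw [Finset.sum_congr rfl fun x _ => h2 x]
    simp
  rw [map_sum, h1, map_smul, LinearMap.trace_one, smul_eq_mul] at h
  rw [hc, Representation.char_one, h, mul_div_cancel_right₀ _ h0]

/-! ### Irreducible representations separate the group algebra -/

theorem Representation.asAlgebraHom_transport {G V W : Type*} [Group G]
    [AddCommGroup V] [Module ℂ V] [AddCommGroup W] [Module ℂ W]
    (ρ : Representation ℂ G V) (e : V ≃ₗ[ℂ] W) (a : ℂ[G]) :
    (ρ.transport e).asAlgebraHom a = e.conj (ρ.asAlgebraHom a) := by
  have : (ρ.transport e).asAlgebraHom = (e.conjAlgEquiv ℂ).toAlgHom.comp ρ.asAlgebraHom := by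
    refine MonoidAlgebra.algHom_ext (R := ℂ) (fun g => ?_) (by ext)
    simp only [Representation.asAlgebraHom_single, one_smul, AlgHom.comp_apply]
    rfl
  rw [this]
  rfl

theorem Representation.isIrreducible_ofModule' {G M : Type*} [Group G] [AddCommGroup M]
    [Module ℂ M] [Module ℂ[G] M] [IsScalarTower ℂ ℂ[G] M] [IsSimpleModule ℂ[G] M] :
    (Representation.ofModule' (k := ℂ) (G := G) M).IsIrreducible := by
  have hnt : Nontrivial M := IsSimpleModule.nontrivial ℂ[G] M
  have hnt' : Nontrivial (Subrepresentation (Representation.ofModule' (k := ℂ) (G := G) M)) :=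
    ⟨⊥, ⊤, fun h => bot_ne_top (α := Submodule ℂ M) (congrArg Subrepresentation.toSubmodule h)⟩
  refine ⟨fun U => ?_⟩
  let U' : Submodule ℂ[G] M :=
    { U.toSubmodule with
      smul_mem' := fun a v hv => by
        induction a using MonoidAlgebra.induction_on with
        | of g => exact U.apply_mem_toSubmodule g hv
        | add a b ha hb => rw [add_smul]; exact U.toSubmodule.add_mem ha hb
        | smul r a ha => rw [smul_assoc]; exact U.toSubmodule.smul_mem r ha }
  rcases eq_bot_or_eq_top U' with h | h
  · left
    refine Subrepresentation.toSubmodule_injective (SetLike.coe_injective ?_)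
    exact congrArg (fun W : Submodule ℂ[G] M => (W : Set M)) h
  · right
    refine Subrepresentation.toSubmodule_injective (SetLike.coe_injective ?_)
    exact congrArg (fun W : Submodule ℂ[G] M => (W : Set M)) h

theorem MonoidAlgebra.smul_eq_zero_of_forall_irreducible {G M : Type*} [Group G] [Finite G]
    [AddCommGroup M] [Module ℂ[G] M] [Module.Finite ℂ[G] M] [IsSimpleModule ℂ[G] M] (a : ℂ[G])
    (h : ∀ (n : ℕ) (ρ : Representation ℂ G (Fin n → ℂ)), ρ.IsIrreducible →
      ρ.asAlgebraHom a = 0) (m : M) : a • m = 0 := by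
  let _ : Module ℂ M := Module.compHom M (algebraMap ℂ ℂ[G])
  have _ : IsScalarTower ℂ ℂ[G] M := IsScalarTower.of_compHom ℂ ℂ[G] M
  have hfd : FiniteDimensional ℂ M := Module.Finite.trans ℂ[G] _
  have h1 := h _ _ ((Representation.isIrreducible_ofModule' (G := G) (M := M)).transport
    (Module.finBasis ℂ M).equivFun)
  rw [Representation.asAlgebraHom_transport, LinearEquiv.map_eq_zero_iff] at h1
  have h2 := LinearMap.congr_fun h1 m
  rwa [Representation.asAlgebraHom, Representation.ofModule', Equiv.apply_symm_apply] at h2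

/-- An element of the group algebra acting as zero in every irreducible representation is zero. -/
theorem MonoidAlgebra.eq_zero_of_forall_irreducible {G : Type*} [Group G] [Finite G] (a : ℂ[G])
    (h : ∀ (n : ℕ) (ρ : Representation ℂ G (Fin n → ℂ)), ρ.IsIrreducible →
      ρ.asAlgebraHom a = 0) : a = 0 := by
  have hss : IsSemisimpleRing ℂ[G] := inferInstance
  have hmem : a ∈ Module.jacobson ℂ[G] ℂ[G] := by
    rw [Module.jacobson, Submodule.mem_sInf]
    intro I hI
    have hs : IsSimpleModule ℂ[G] (ℂ[G] ⧸ I) := isSimpleModule_iff_isCoatom.mpr hI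
    -- Acting on the class of 1 in the simple module `ℂ[G] ⧸ I` shows `a ∈ I` for every maximal `I`.
    -- By Maschke the Jacobson radical is zero.
    have := smul_eq_zero_of_forall_irreducible a h (Submodule.Quotient.mk (p := I) 1)
    rwa [← Submodule.Quotient.mk_smul, smul_eq_mul, mul_one,
      Submodule.Quotient.mk_eq_zero] at this
  rw [IsSemisimpleModule.jacobson_eq_bot] at hmem
  simpa using hmem

/-! ### Finite-order operators with trace of maximal modulus -/

theorem Multiset.eq_of_norm_sum_eq_card {s : Multiset ℂ} (hs : ∀ z ∈ s, ‖z‖ = 1)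
    (hsum : ‖s.sum‖ = s.card) (h0 : s.card ≠ 0) : ∃ u, ‖u‖ = 1 ∧ ∀ z ∈ s, z = u := by
  have h0' : (s.card : ℝ) ≠ 0 := by exact_mod_cast h0
  -- The mean `u` is the common value: the defects `1 - Re(ū z)` are nonnegative and sum to zero.
  set u : ℂ := s.sum / s.card with hu
  have hun : ‖u‖ = 1 := by
    rw [hu, norm_div, hsum, Complex.norm_natCast, div_self h0']
  have huc : (starRingEnd ℂ u) * u = 1 := by
    rw [mul_comm, Complex.mul_conj, Complex.normSq_eq_norm_sq, hun]; simp
  have key : ∀ z ∈ s, 1 - ((starRingEnd ℂ u) * z).re = 0 := by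
    have h1 : ∀ z ∈ s, 0 ≤ 1 - ((starRingEnd ℂ u) * z).re := fun z hz => by
      have := Complex.re_le_norm ((starRingEnd ℂ u) * z)
      rw [norm_mul, RCLike.norm_conj, hun, hs z hz] at this
      linarith
    have h2 : (s.map fun z => 1 - ((starRingEnd ℂ u) * z).re).sum = 0 := by
      have h3 : (s.map fun z => ((starRingEnd ℂ u) * z).re).sum
          = ((starRingEnd ℂ u) * s.sum).re := by
        refine s.induction_on (by simp) fun z t ih => ?_
        rw [Multiset.map_cons, Multiset.sum_cons, Multiset.sum_cons, ih, mul_add, Complex.add_re]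
      rw [Multiset.sum_map_sub, h3, show s.sum = u * s.card by
        rw [hu, div_mul_cancel₀]; exact_mod_cast h0, ← mul_assoc, huc]
      simp
    intro z hz
    exact Multiset.all_zero_of_le_zero_le_of_sum_eq_zero
      (s := s.map fun z => 1 - ((starRingEnd ℂ u) * z).re)
      (by simpa using h1) h2 _ (Multiset.mem_map_of_mem _ hz)
  refine ⟨u, hun, fun z hz => ?_⟩
  have h1 := key z hz
  have hw : ‖(starRingEnd ℂ u) * z‖ = 1 := by
    rw [norm_mul, RCLike.norm_conj, hun, hs z hz, one_mul]
  have h2 : (starRingEnd ℂ u) * z = 1 := by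
    have hsq := Complex.sq_norm ((starRingEnd ℂ u) * z)
    rw [hw, Complex.normSq_apply] at hsq
    have hre : ((starRingEnd ℂ u) * z).re = 1 := by linarith
    have him : ((starRingEnd ℂ u) * z).im = 0 := by
      rw [hre] at hsq
      nlinarith
    exact Complex.ext hre him
  calc z = (u * starRingEnd ℂ u) * z := by rw [mul_comm u, huc, one_mul]
    _ = u := by rw [mul_assoc, h2, mul_one]

-- The eigenvalues are roots of unity whose sum has maximal modulus, so all equal some `u`. As `u`
-- is a simple root of `X ^ m - 1`, the operator is annihilated by `X - u` itself.
open Polynomial in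
theorem Module.End.eq_smul_one_of_norm_trace_eq {V : Type*} [AddCommGroup V] [Module ℂ V]
    [FiniteDimensional ℂ V] [Nontrivial V] {T : Module.End ℂ V} {m : ℕ} (hm : m ≠ 0)
    (hT : T ^ m = 1) (htr : ‖LinearMap.trace ℂ V T‖ = Module.finrank ℂ V) :
    ∃ u : ℂ, T = u • 1 := by
  have hsplit : T.charpoly.Splits := IsAlgClosed.splits _
  have hcard : T.charpoly.roots.card = Module.finrank ℂ V := by
    rw [← LinearMap.charpoly_natDegree T]
    exact splits_iff_card_roots.mp hsplit
  have hroot : ∀ z ∈ T.charpoly.roots, z ^ m = 1 := by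
    intro z hz
    obtain ⟨v, hv⟩ := ((Module.End.hasEigenvalue_iff_isRoot_charpoly T z).mpr
      (isRoot_of_mem_roots hz)).exists_hasEigenvector
    have h1 := hv.pow_apply m
    rw [hT, Module.End.one_apply] at h1
    have h2 : (z ^ m - 1) • v = 0 := by rw [sub_smul, ← h1, one_smul, sub_self]
    rcases smul_eq_zero.mp h2 with h | h
    · exact sub_eq_zero.mp h
    · exact absurd h hv.2
  obtain ⟨u, hu, hall⟩ := Multiset.eq_of_norm_sum_eq_card (s := T.charpoly.roots)
    (fun z hz => Complex.norm_eq_one_of_pow_eq_one (hroot z hz) hm)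
    (by rw [hcard, ← htr, Module.End.trace_eq_sum_roots_charpoly_of_splits hsplit])
    (by rw [hcard]; exact Module.finrank_pos.ne')
  have hrep : T.charpoly.roots = Multiset.replicate (Module.finrank ℂ V) u :=
    Multiset.eq_replicate.mpr ⟨hcard, hall⟩
  have hum : u ^ m = 1 := hroot u (by
    rw [hrep]; exact Multiset.mem_replicate.mpr ⟨Module.finrank_pos.ne', rfl⟩)
  have hchar : T.charpoly = (X - C u) ^ Module.finrank ℂ V := by
    rw [hsplit.eq_prod_roots_of_monic T.charpoly_monic, hrep]
    simp
  set q : ℂ[X] := (X ^ m - 1) /ₘ (X - C u)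
  have hq : (X - C u) * q = X ^ m - 1 := by
    refine mul_divByMonic_eq_iff_isRoot.mpr ?_
    simp [hum]
  have hcop : IsCoprime ((X - C u) ^ Module.finrank ℂ V) q := by
    refine IsCoprime.pow_left (isCoprime_of_is_root_of_eval_derivative_ne_zero _ u ?_)
    have : u ≠ 0 := by rintro rfl; simp at hu
    simp [derivative_X_pow, hm, this]
  obtain ⟨a, b, hab⟩ := hcop
  have h1 : aeval T (b * q) = 1 := by
    have := congrArg (aeval T) hab
    rwa [map_add, map_mul, ← hchar, LinearMap.aeval_self_charpoly, mul_zero, zero_add,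
      map_one] at this
  have h2 : aeval T ((X - C u) * q) = 0 := by rw [hq]; simp [hT]
  refine ⟨u, ?_⟩
  have h3 : aeval T (X - C u) = 0 := by
    calc aeval T (X - C u) = aeval T (b * q) * aeval T (X - C u) := by rw [h1, one_mul]
      _ = aeval T b * aeval T ((X - C u) * q) := by rw [← map_mul, ← map_mul]; congr 1; ring
      _ = 0 := by rw [h2, mul_zero]
  have h4 : T - algebraMap ℂ _ u = 0 := by simpa using h3
  rw [sub_eq_zero.mp h4, Algebra.algebraMap_eq_smul_one]

/-! ### Kernel and center of a character in terms of scalar operators -/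

namespace Representation

variable {G V : Type*} [Group G] [Finite G] [AddCommGroup V] [Module ℂ V]
  [FiniteDimensional ℂ V] [Nontrivial V] (ρ : Representation ℂ G V)

omit [Finite G] in
theorem character_one_ne_zero : ρ.character 1 ≠ 0 := by
  rw [Representation.char_one]
  exact_mod_cast (Module.finrank_pos (R := ℂ) (M := V)).ne'

omit [FiniteDimensional ℂ V] in
theorem norm_smul_one_eq {g : G} {c : ℂ} (h : ρ g = c • 1) : ‖c‖ = 1 := by
  have hp : ρ g ^ Nat.card G = 1 := by rw [← map_pow, pow_card_eq_one', map_one]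
  rw [h, smul_pow, one_pow] at hp
  obtain ⟨v, hv⟩ := exists_ne (0 : V)
  have h1 := LinearMap.congr_fun hp v
  have h2 : (c ^ Nat.card G - 1) • v = 0 := by
    rw [sub_smul, one_smul, sub_eq_zero]; exact h1
  rcases smul_eq_zero.mp h2 with h | h
  · exact Complex.norm_eq_one_of_pow_eq_one (sub_eq_zero.mp h) Nat.card_pos.ne'
  · exact absurd h hv

omit [Finite G] [Nontrivial V] in
theorem character_eq_of_eq_smul_one {g : G} {c : ℂ} (h : ρ g = c • 1) :
    ρ.character g = c * ρ.character 1 := by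
  simp [Representation.character, h]

theorem mem_charCenter_iff {g : G} : g ∈ charCenter ρ.character ↔ ∃ c : ℂ, ρ g = c • 1 := by
  constructor
  · intro h
    refine Module.End.eq_smul_one_of_norm_trace_eq (m := Nat.card G) Nat.card_pos.ne' ?_ ?_
    · rw [← map_pow, pow_card_eq_one', map_one]
    · change ((‖ρ.character g‖ : ℝ) : ℂ) = ρ.character 1 at h
      rw [Representation.char_one] at h
      exact_mod_cast h
  · rintro ⟨c, hc⟩
    change ((‖ρ.character g‖ : ℝ) : ℂ) = ρ.character 1
    rw [ρ.character_eq_of_eq_smul_one hc, norm_mul, ρ.norm_smul_one_eq hc, one_mul,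
      Representation.char_one, Complex.norm_natCast]
    simp

theorem mem_charKernel_iff {g : G} : g ∈ charKernel ρ.character ↔ ρ g = 1 := by
  constructor
  · intro h
    change ρ.character g = ρ.character 1 at h
    obtain ⟨c, hc⟩ := ρ.mem_charCenter_iff.mp (show g ∈ charCenter ρ.character by
      change ((‖ρ.character g‖ : ℝ) : ℂ) = ρ.character 1
      rw [h, Representation.char_one, Complex.norm_natCast]
      simp)
    rw [ρ.character_eq_of_eq_smul_one hc] at h
    rw [hc, (mul_eq_right₀ ρ.character_one_ne_zero).mp h, one_smul]
  · intro h
    change ρ.character g = ρ.character 1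
    simp [Representation.character, h]

theorem hasCentralType_iff :
    HasCentralType ρ.character ↔ ∀ g, ρ.character g = 0 ∨ ∃ c : ℂ, ρ g = c • 1 := by
  refine forall_congr' fun g => ?_
  rw [ρ.mem_charCenter_iff]
  tauto

end Representation

/-! ### The normal subgroup `[g, G]` -/

section ElementCommutator

variable {G : Type*} [Group G]

/-- The normal subgroup `[g, G]` generated by the commutators of `g` with all elements of `G`. -/
def elementCommutator (g : G) : Subgroup G :=
  Subgroup.normalClosure (Set.range fun x => x * g * x⁻¹ * g⁻¹)

instance elementCommutator_normal (g : G) : (elementCommutator g).Normal :=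
  Subgroup.normalClosure_normal

theorem conj_mul_inv_mem_elementCommutator (g x : G) :
    x * g * x⁻¹ * g⁻¹ ∈ elementCommutator g :=
  Subgroup.subset_normalClosure ⟨x, rfl⟩

theorem elementCommutator_le {L : Subgroup G} [L.Normal] {g : G}
    (h : ∀ x, x * g * x⁻¹ * g⁻¹ ∈ L) : elementCommutator g ≤ L :=
  Subgroup.normalClosure_le_normal (by rintro _ ⟨x, rfl⟩; exact h x)

theorem elementCommutator_le_of_mem {L : Subgroup G} [hL : L.Normal] {g : G} (hg : g ∈ L) :
    elementCommutator g ≤ L :=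
  elementCommutator_le fun x => L.mul_mem (hL.conj_mem g hg x) (L.inv_mem hg)

theorem mem_center_of_elementCommutator_eq_bot {g : G} (h : elementCommutator g = ⊥) :
    g ∈ Subgroup.center G := by
  rw [Subgroup.mem_center_iff]
  intro x
  have := conj_mul_inv_mem_elementCommutator g x
  rw [h, Subgroup.mem_bot, mul_inv_eq_one, mul_inv_eq_iff_eq_mul] at this
  exact this

theorem Representation.eq_one_of_mem_elementCommutator {V : Type*} [AddCommGroup V] [Module ℂ V]
    (ρ : Representation ℂ G V) {g : G} {c : ℂ} (h : ρ g = c • 1) {k : G}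
    (hk : k ∈ elementCommutator g) : ρ k = 1 := by
  have : elementCommutator g ≤ MonoidHom.ker ρ := elementCommutator_le fun x => by
    rw [MonoidHom.mem_ker, map_mul, map_mul, map_mul, h, mul_smul_comm, mul_one, smul_mul_assoc,
      ← map_mul, mul_inv_cancel, map_one, ← h, ← map_mul, mul_inv_cancel, map_one]
  exact this hk

end ElementCommutator

/-! ### Conjugacy relations forced by central type -/

section CentralType

variable {G : Type*} [Group G] [Finite G]

theorem Representation.IsIrreducible.trivial_or_centralType {M : Subgroup G}
    (hM : ∀ χ ∈ IrrOver G M, HasCentralType χ) {V : Type*} [AddCommGroup V] [Module ℂ V]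
    [FiniteDimensional ℂ V] {ρ : Representation ℂ G V} (hρ : ρ.IsIrreducible) :
    (∀ m ∈ M, ρ m = 1) ∨ ∀ g, ρ.character g = 0 ∨ ∃ c : ℂ, ρ g = c • 1 := by
  have := hρ.nontrivial_space
  by_cases h : (M : Set G) ⊆ charKernel ρ.character
  · exact Or.inl fun m hm => ρ.mem_charKernel_iff.mp (h hm)
  · exact Or.inr (ρ.hasCentralType_iff.mp (hM _ ⟨character_mem_Irr hρ, h⟩))

theorem MonoidAlgebra.liftNC_eq_zero_of_forall_irreducible (a : ℂ[G])
    (h : ∀ (n : ℕ) (ρ : Representation ℂ G (Fin n → ℂ)), ρ.IsIrreducible →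
      ρ.asAlgebraHom a = 0) (φ : G → ℂ) :
    MonoidAlgebra.liftNC (AddMonoidHom.id ℂ) φ a = 0 := by
  rw [MonoidAlgebra.eq_zero_of_forall_irreducible a h, map_zero]

/-- This is `(1 - m) Σ = 0` in `ℂ[G]`, with `Σ` the class sum of `g`, evaluated against a test
function `φ`. -/
theorem sum_conj_eq_sum_mul_conj [Fintype G] {M : Subgroup G}
    (hM : ∀ χ ∈ IrrOver G M, HasCentralType χ) {g m : G} (hm : m ∈ M)
    (hmg : m ∈ elementCommutator g) (φ : G → ℂ) :
    ∑ x, φ (x * g * x⁻¹) = ∑ x, φ (m * (x * g * x⁻¹)) := by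
  have := MonoidAlgebra.liftNC_eq_zero_of_forall_irreducible
    (∑ x : G, (MonoidAlgebra.single (x * g * x⁻¹) (1 : ℂ) -
      MonoidAlgebra.single (m * (x * g * x⁻¹)) 1)) (fun n ρ hρ => by
    have hsum : ρ.asAlgebraHom (∑ x : G, (MonoidAlgebra.single (x * g * x⁻¹) (1 : ℂ) -
        MonoidAlgebra.single (m * (x * g * x⁻¹)) 1)) =
        (1 - ρ m) * ∑ x : G, ρ (x * g * x⁻¹) := by
      rw [map_sum, Finset.mul_sum]
      refine Finset.sum_congr rfl fun x _ => ?_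
      rw [map_sub, Representation.asAlgebraHom_single_one, Representation.asAlgebraHom_single_one,
        map_mul ρ m, sub_mul, one_mul]
    rw [hsum]
    rcases hρ.trivial_or_centralType hM with h | h
    · rw [h m hm, sub_self, zero_mul]
    · rcases h g with h | ⟨c, hc⟩
      · rw [hρ.sum_conj_eq, h]; simp
      · rw [ρ.eq_one_of_mem_elementCommutator hc hmg, sub_self, zero_mul]) φ
  simp only [map_sum, map_sub, MonoidAlgebra.liftNC_single, AddMonoidHom.id_apply, one_mul,
    Finset.sum_sub_distrib] at this
  exact sub_eq_zero.mp this

/-- This is `(1 - m)(1 - k) Σ = 0` against a test function. Now `m` need not lie in `[g, G]`: each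
irreducible representation kills `1 - m`, `1 - k` or `Σ`. -/
theorem sum_conj_inclusion_exclusion [Fintype G] {M : Subgroup G}
    (hM : ∀ χ ∈ IrrOver G M, HasCentralType χ) {g m k : G} (hm : m ∈ M)
    (hk : k ∈ elementCommutator g) (φ : G → ℂ) :
    ∑ x, φ (x * g * x⁻¹) - ∑ x, φ (k * (x * g * x⁻¹)) - (∑ x, φ (m * (x * g * x⁻¹)) -
      ∑ x, φ (m * (k * (x * g * x⁻¹)))) = 0 := by
  have := MonoidAlgebra.liftNC_eq_zero_of_forall_irreducible
    (∑ x : G, (MonoidAlgebra.single (x * g * x⁻¹) (1 : ℂ) -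
      MonoidAlgebra.single (k * (x * g * x⁻¹)) 1 -
      (MonoidAlgebra.single (m * (x * g * x⁻¹)) 1 -
        MonoidAlgebra.single (m * (k * (x * g * x⁻¹))) 1))) (fun n ρ hρ => by
    have hsum : ρ.asAlgebraHom (∑ x : G, (MonoidAlgebra.single (x * g * x⁻¹) (1 : ℂ) -
      MonoidAlgebra.single (k * (x * g * x⁻¹)) 1 -
      (MonoidAlgebra.single (m * (x * g * x⁻¹)) 1 -
        MonoidAlgebra.single (m * (k * (x * g * x⁻¹))) 1))) =
        (1 - ρ m) * (1 - ρ k) * ∑ x : G, ρ (x * g * x⁻¹) := by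
      rw [map_sum, Finset.mul_sum]
      refine Finset.sum_congr rfl fun x _ => ?_
      simp only [map_sub, Representation.asAlgebraHom_single_one, map_mul ρ m, map_mul ρ k]
      simp only [sub_mul, mul_sub, one_mul, mul_one, mul_assoc]
      abel
    rw [hsum]
    rcases hρ.trivial_or_centralType hM with h | h
    · rw [h m hm, sub_self, zero_mul, zero_mul]
    · rcases h g with h | ⟨c, hc⟩
      · rw [hρ.sum_conj_eq, h]; simp
      · rw [ρ.eq_one_of_mem_elementCommutator hc hk, sub_self, mul_zero, zero_mul]) φ
  simpa only [map_sum, map_sub, MonoidAlgebra.liftNC_single, AddMonoidHom.id_apply, one_mul,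
    Finset.sum_sub_distrib] using this

theorem isConj_mul_of_le_elementCommutator {M : Subgroup G}
    (hM : ∀ χ ∈ IrrOver G M, HasCentralType χ) {g m : G} (hm : m ∈ M)
    (hmg : m ∈ elementCommutator g) : IsConj g (m * g) := by
  classical
  have := Fintype.ofFinite G
  by_contra hcon
  -- The test function marks the nonconjugates of `g`. Its values are natural numbers, so a zero sum
  -- forces every term to vanish, in particular the one at `x = 1`.
  have h := sum_conj_eq_sum_mul_conj hM hm hmg
    (fun y => ((if IsConj g y then 0 else 1 : ℕ) : ℂ))
  rw [Finset.sum_eq_zero fun x _ => by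
    rw [if_pos (isConj_iff.mpr ⟨x, rfl⟩), Nat.cast_zero]] at h
  rw [← Nat.cast_sum] at h
  have h2 := Finset.sum_eq_zero_iff.mp (Nat.cast_eq_zero.mp h.symm) 1 (Finset.mem_univ _)
  simp only [inv_one, mul_one, one_mul, if_neg hcon, one_ne_zero] at h2

theorem isConj_mul_of_inf_eq_bot {M : Subgroup G}
    (hM : ∀ χ ∈ IrrOver G M, HasCentralType χ) (hbot : M ≠ ⊥) {g k : G}
    (hinf : elementCommutator g ⊓ M = ⊥) (hk : k ∈ elementCommutator g) :
    IsConj g (k * g) := by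
  classical
  have := Fintype.ofFinite G
  by_contra hcon
  obtain ⟨⟨m, hm⟩, hm'⟩ := Subgroup.ne_bot_iff_exists_ne_one.mp hbot
  have hm1 : m ≠ 1 := fun h1 => hm' (Subtype.ext h1)
  -- `P` singles out the part of the coset `[g, G] g` not conjugate to `g`. Multiplication by `m ≠
  -- 1` in `M` leaves this coset, so of the four sums only the one with `k` alone could be nonzero.
  let P : G → Prop := fun y => y * g⁻¹ ∈ elementCommutator g ∧ ¬ IsConj g y
  have hP : ∀ l ∈ elementCommutator g, ∀ x, ¬ P (m * (l * (x * g * x⁻¹))) := by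
    intro l hl x hx
    have h1 := hx.1
    have h2 : m * (l * (x * g * x⁻¹)) * g⁻¹ = m * (l * (x * g * x⁻¹ * g⁻¹)) := by group
    rw [h2, Subgroup.mul_mem_cancel_right _
      (Subgroup.mul_mem _ hl (conj_mul_inv_mem_elementCommutator g x))] at h1
    have h3 : m ∈ elementCommutator g ⊓ M := ⟨h1, hm⟩
    rw [hinf] at h3
    exact hm1 h3
  have h := sum_conj_inclusion_exclusion hM hm hk (fun y => ((if P y then 1 else 0 : ℕ) : ℂ))
  have e1 : ∑ x, ((if P (x * g * x⁻¹) then 1 else 0 : ℕ) : ℂ) = 0 :=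
    Finset.sum_eq_zero fun x _ => by
      rw [if_neg (fun hx => hx.2 (isConj_iff.mpr ⟨x, rfl⟩)), Nat.cast_zero]
  have e2 : ∑ x, ((if P (m * (x * g * x⁻¹)) then 1 else 0 : ℕ) : ℂ) = 0 :=
    Finset.sum_eq_zero fun x _ => by
      rw [if_neg (by simpa using hP 1 (Subgroup.one_mem _) x), Nat.cast_zero]
  have e3 : ∑ x, ((if P (m * (k * (x * g * x⁻¹))) then 1 else 0 : ℕ) : ℂ) = 0 :=
    Finset.sum_eq_zero fun x _ => by rw [if_neg (hP k hk x), Nat.cast_zero]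
  rw [e1, e2, e3, sub_zero, sub_zero, zero_sub, neg_eq_zero, ← Nat.cast_sum] at h
  have h2 := Finset.sum_eq_zero_iff.mp (Nat.cast_eq_zero.mp h) 1 (Finset.mem_univ _)
  rw [if_pos ⟨by simpa using hk, by simpa only [inv_one, mul_one, one_mul] using hcon⟩] at h2
  exact one_ne_zero h2

end CentralType

/-! ### Inflation along surjections -/

theorem Representation.IsIrreducible.comp_surjective {G H V : Type*} [Group G] [Group H]
    [AddCommGroup V] [Module ℂ V] {ρ : Representation ℂ H V} (hρ : ρ.IsIrreducible)
    {f : G →* H} (hf : Function.Surjective f) :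
    Representation.IsIrreducible (MonoidHom.comp ρ f : Representation ℂ G V) := by
  let e : Subrepresentation (MonoidHom.comp ρ f : Representation ℂ G V) ≃o Subrepresentation ρ :=
    { toFun := fun U => ⟨U.toSubmodule, fun h v hv => by
        obtain ⟨g, rfl⟩ := hf h
        exact U.apply_mem_toSubmodule g hv⟩
      invFun := fun U => ⟨U.toSubmodule, fun g v hv => U.apply_mem_toSubmodule (f g) hv⟩
      left_inv := fun U => rfl
      right_inv := fun U => rfl
      map_rel_iff' := Iff.rfl }
  exact (OrderIso.isSimpleOrder_iff e).mpr hρ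

theorem comp_mem_Irr {G H : Type*} [Group G] [Group H] {χ : H → ℂ} (hχ : χ ∈ Irr H)
    {f : G →* H} (hf : Function.Surjective f) : χ ∘ f ∈ Irr G := by
  obtain ⟨n, ρ, hρ, rfl⟩ := hχ
  exact ⟨n, _, hρ.comp_surjective hf, rfl⟩

theorem mem_charCenter_comp {G H : Type*} [Group G] [Group H] {χ : H → ℂ} {f : G →* H} {g : G} :
    g ∈ charCenter (χ ∘ f) ↔ f g ∈ charCenter χ := by
  simp [charCenter]

theorem mem_charKernel_comp {G H : Type*} [Group G] [Group H] {χ : H → ℂ} {f : G →* H} {g : G} :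
    g ∈ charKernel (χ ∘ f) ↔ f g ∈ charKernel χ := by
  simp [charKernel]

theorem HasCentralType.of_comp {G H : Type*} [Group G] [Group H] {χ : H → ℂ} {f : G →* H}
    (hf : Function.Surjective f) (h : HasCentralType (χ ∘ f)) : HasCentralType χ := by
  intro y hy
  obtain ⟨g, rfl⟩ := hf y
  exact h g fun hg => hy (mem_charCenter_comp.mp hg)

theorem centralType_irrOver_map {G H : Type*} [Group G] [Group H] {M : Subgroup G}
    (hM : ∀ χ ∈ IrrOver G M, HasCentralType χ) {f : G →* H} (hf : Function.Surjective f) :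
    ∀ χ ∈ IrrOver H (M.map f), HasCentralType χ := fun χ hχ =>
  (hM (χ ∘ f) ⟨comp_mem_Irr hχ.1 hf, fun h => hχ.2 (by
    rintro _ ⟨m, hm, rfl⟩
    exact mem_charKernel_comp.mp (h hm))⟩).of_comp hf

theorem centralType_irrOver_mono {G : Type*} [Group G] {M N : Subgroup G} (hMN : M ≤ N)
    (hN : ∀ χ ∈ IrrOver G N, HasCentralType χ) : ∀ χ ∈ IrrOver G M, HasCentralType χ :=
  fun χ hχ => hN χ ⟨hχ.1, fun h => hχ.2 fun _ hm => h (hMN hm)⟩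

/-! ### Flat elements and central elements -/

section Flat

variable {G : Type*} [Group G]

theorem notMem_elementCommutator_of_isConj {x : G} (hx : x ≠ 1)
    (h : ∀ k ∈ elementCommutator x, IsConj x (k * x)) : x ∉ elementCommutator x := by
  intro hmem
  have := h x⁻¹ (Subgroup.inv_mem _ hmem)
  rw [inv_mul_cancel] at this
  exact hx (isConj_one_left.mp this)

theorem IsConj.pow_eq_one {x y : G} (h : IsConj x y) {n : ℕ} (hx : x ^ n = 1) : y ^ n = 1 := by
  obtain ⟨c, rfl⟩ := isConj_iff.mp h
  rw [conj_pow, hx, mul_one, mul_inv_cancel]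

/-- Since `x` is central, `(x * b) ^ n = x ^ n * b ^ n`, so `x ^ n = 1` as well as `x ^ m = 1`. -/
theorem eq_one_of_isConj_mul_of_coprime {x b : G} (hx : x ∈ Subgroup.center G)
    (h : IsConj b (x * b)) {n m : ℕ} (hb : b ^ n = 1) (hxm : x ^ m = 1) (hnm : n.Coprime m) :
    x = 1 := by
  have hc : Commute x b := (Subgroup.mem_center_iff.mp hx b).symm
  have h1 := h.pow_eq_one hb
  rw [hc.mul_pow, hb, mul_one] at h1
  rw [← orderOf_eq_one_iff]
  exact Nat.eq_one_of_dvd_coprimes hnm (orderOf_dvd_of_pow_eq_one h1)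
    (orderOf_dvd_of_pow_eq_one hxm)

/-- Take `x` with `[x, G]` minimal. For `y ≠ 1` in `[x, G]`, minimality would give `[y, G] = [x,
G]`, which contains `y`, contrary to flatness. -/
theorem exists_central_ne_one_of_isConj [Finite G] {L : Subgroup G} [L.Normal] (hL : L ≠ ⊥)
    (h : ∀ x ∈ L, ∀ k ∈ elementCommutator x, IsConj x (k * x)) :
    ∃ x ∈ L, x ≠ 1 ∧ x ∈ Subgroup.center G := by
  obtain ⟨x₀, hx₀⟩ := Subgroup.ne_bot_iff_exists_ne_one.mp hL
  obtain ⟨x, ⟨hxL, hx1⟩, hmin⟩ := WellFounded.has_min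
    (InvImage.wf (fun x : G => elementCommutator x) wellFounded_lt)
    {x | x ∈ L ∧ x ≠ 1} ⟨x₀, x₀.2, fun h => hx₀ (Subtype.ext h)⟩
  refine ⟨x, hxL, hx1, mem_center_of_elementCommutator_eq_bot ?_⟩
  by_contra hK
  obtain ⟨y, hy⟩ := Subgroup.ne_bot_iff_exists_ne_one.mp hK
  have hy1 : (y : G) ≠ 1 := fun h => hy (Subtype.ext h)
  have hyL : (y : G) ∈ L := elementCommutator_le_of_mem hxL y.2
  refine hmin y ⟨hyL, hy1⟩ (lt_of_le_of_ne (elementCommutator_le_of_mem y.2) fun heq => ?_)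
  exact notMem_elementCommutator_of_isConj hy1 (h y hyL) (heq.ge y.2)

theorem exists_central_orderOf_eq_prime [Finite G] {p : ℕ} [hp : Fact p.Prime] {N : Subgroup G}
    [N.Normal] (hN : ∀ χ ∈ IrrOver G N, HasCentralType χ) (hpN : p ∣ Nat.card N) :
    ∃ z ∈ N, z ∈ Subgroup.center G ∧ orderOf z = p := by
  have hflat : ∀ x ∈ N, ∀ k ∈ elementCommutator x, IsConj x (k * x) := fun x hx k hk =>
    isConj_mul_of_le_elementCommutator
      (centralType_irrOver_mono (elementCommutator_le_of_mem hx) hN) hk hk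
  obtain ⟨n₀, hn₀⟩ := exists_prime_orderOf_dvd_card' p hpN
  -- Minimize `[x, G]` over the nontrivial `p`-elements only: then `[n, G]` has order prime to `p`,
  -- and a nontrivial central element in it would contradict flatness of `n`.
  obtain ⟨n, ⟨hnN, hn1, k, hk⟩, hmin⟩ := WellFounded.has_min
    (InvImage.wf (fun x : G => elementCommutator x) wellFounded_lt)
    {x | x ∈ N ∧ x ≠ 1 ∧ ∃ k : ℕ, x ^ p ^ k = 1} ⟨n₀, n₀.2, fun h => by
      rw [Subtype.ext (a2 := (1 : N)) h, orderOf_one] at hn₀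
      exact hp.out.one_lt.ne hn₀, 1, by
      rw [pow_one, ← Subgroup.coe_pow, ← hn₀, pow_orderOf_eq_one, Subgroup.coe_one]⟩
  have hKN : elementCommutator n ≤ N := elementCommutator_le_of_mem hnN
  have hpK : ¬ p ∣ Nat.card (elementCommutator n) := by
    intro hdvd
    obtain ⟨y, hy⟩ := exists_prime_orderOf_dvd_card' p hdvd
    have hy1 : (y : G) ≠ 1 := fun h => by
      rw [Subtype.ext (a2 := (1 : elementCommutator n)) h, orderOf_one] at hy
      exact hp.out.one_lt.ne hy
    refine hmin y ⟨hKN y.2, hy1, 1, by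
      rw [pow_one, ← Subgroup.coe_pow, ← hy, pow_orderOf_eq_one, Subgroup.coe_one]⟩
      (lt_of_le_of_ne (elementCommutator_le_of_mem y.2) fun heq => ?_)
    exact notMem_elementCommutator_of_isConj hy1 (hflat y (hKN y.2)) (heq.ge y.2)
  have hK : elementCommutator n = ⊥ := by
    by_contra hK
    obtain ⟨x, hxK, hx1, hxc⟩ := exists_central_ne_one_of_isConj hK fun x hx => hflat x (hKN hx)
    refine hx1 (eq_one_of_isConj_mul_of_coprime hxc (hflat n hnN x hxK) hk
      (m := Nat.card (elementCommutator n)) ?_ ?_)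
    · have := pow_card_eq_one' (x := (⟨x, hxK⟩ : elementCommutator n))
      exact congrArg Subtype.val this
    · exact Nat.Coprime.pow_left _ ((Nat.Prime.coprime_iff_not_dvd hp.out).mpr hpK)
  have hnc := mem_center_of_elementCommutator_eq_bot hK
  have hdvd : p ∣ Nat.card (Subgroup.zpowers n) := by
    rw [Nat.card_zpowers]
    obtain ⟨j, -, hj⟩ := (Nat.dvd_prime_pow hp.out).mp (orderOf_dvd_of_pow_eq_one hk)
    rw [hj]
    refine dvd_pow_self p fun h0 => hn1 ?_
    rwa [h0, pow_zero, orderOf_eq_one_iff] at hj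
  obtain ⟨z, hz⟩ := exists_prime_orderOf_dvd_card' p hdvd
  exact ⟨z, (Subgroup.zpowers_le.mpr hnN) z.2, (Subgroup.zpowers_le.mpr hnc) z.2,
    by rw [Subgroup.orderOf_coe, hz]⟩

end Flat

-- Commutation of `p`-elements with `p'`-elements

universe u

/-- Induction on `|G|`. If `[b, G] ≠ 1`, all its elements are flat because it avoids `⟨z⟩`, so it
contains a central `x ≠ 1`. The hypotheses pass to `G ⧸ ⟨x⟩`, which makes `[a, b]` central; it then
has both `p`-power and `p'` order. -/
theorem commute_of_centralType_over_central {p : ℕ} [hp : Fact p.Prime] :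
    ∀ (n : ℕ) (G : Type u) [Group G] [Finite G], Nat.card G = n → ∀ z ∈ Subgroup.center G,
      orderOf z = p → (∀ χ ∈ IrrOver G (Subgroup.zpowers z), HasCentralType χ) →
      ∀ a b : G, (∃ k : ℕ, a ^ p ^ k = 1) → ¬ p ∣ orderOf b → a * b = b * a := by
  intro n
  induction n using Nat.strong_induction_on with
  | _ n ih =>
  intro G _ _ hcard z hz hzp hM a b ⟨k, hak⟩ hb
  have hcop : (orderOf b).Coprime p := ((Nat.Prime.coprime_iff_not_dvd hp.out).mpr hb).symm
  have hz1 : z ≠ 1 := by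
    rintro rfl
    rw [orderOf_one] at hzp
    exact hp.out.one_lt.ne hzp
  have hzbot : Subgroup.zpowers z ≠ ⊥ := by rwa [ne_eq, Subgroup.zpowers_eq_bot]
  have hinf : elementCommutator b ⊓ Subgroup.zpowers z = ⊥ := by
    rw [Subgroup.eq_bot_iff_forall]
    rintro m ⟨hmb, hmz⟩
    have hmp : m ^ p = 1 := by
      obtain ⟨i, rfl⟩ := Subgroup.mem_zpowers_iff.mp hmz
      rw [← zpow_natCast, ← zpow_mul, mul_comm, zpow_mul, zpow_natCast, ← hzp,
        pow_orderOf_eq_one, one_zpow]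
    exact eq_one_of_isConj_mul_of_coprime ((Subgroup.zpowers_le.mpr hz) hmz)
      (isConj_mul_of_le_elementCommutator hM hmz hmb) (pow_orderOf_eq_one b) hmp hcop
  by_cases hL : elementCommutator b = ⊥
  · exact Subgroup.mem_center_iff.mp (mem_center_of_elementCommutator_eq_bot hL) a
  obtain ⟨x, hxL, hx1, hxc⟩ := exists_central_ne_one_of_isConj hL fun x hx k hk =>
    isConj_mul_of_inf_eq_bot hM hzbot
      (le_bot_iff.mp (hinf ▸ inf_le_inf_right _ (elementCommutator_le_of_mem hx))) hk
  have hXc : Subgroup.zpowers x ≤ Subgroup.center G := Subgroup.zpowers_le.mpr hxc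
  have hXn : (Subgroup.zpowers x).Normal := ⟨fun g hg y => by
    rwa [Subgroup.mem_center_iff.mp (hXc hg) y, mul_inv_cancel_right]⟩
  let f := QuotientGroup.mk' (Subgroup.zpowers x)
  have hf : Function.Surjective f := QuotientGroup.mk'_surjective _
  have hker : ∀ g, f g = 1 ↔ g ∈ Subgroup.zpowers x := fun g => QuotientGroup.eq_one_iff g
  have hlt : Nat.card (G ⧸ Subgroup.zpowers x) < n := by
    rw [← hcard, Subgroup.card_eq_card_quotient_mul_card_subgroup (Subgroup.zpowers x)]
    refine lt_mul_of_one_lt_right Nat.card_pos ?_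
    rw [Nat.card_zpowers]
    exact lt_of_le_of_ne (orderOf_pos x) fun h => hx1 (orderOf_eq_one_iff.mp h.symm)
  have hfz : orderOf (f z) = p := by
    refine ((Nat.dvd_prime hp.out).mp (hzp ▸ orderOf_map_dvd f z)).resolve_left fun h => hz1 ?_
    have hmem := (hker z).mp (orderOf_eq_one_iff.mp h)
    have : z ∈ elementCommutator b ⊓ Subgroup.zpowers z :=
      ⟨(Subgroup.zpowers_le.mpr hxL) hmem, Subgroup.mem_zpowers z⟩
    rwa [hinf] at this
  have hab := ih _ hlt (G ⧸ Subgroup.zpowers x) rfl (f z)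
    (Subgroup.mem_center_iff.mpr fun y => by
      obtain ⟨g, rfl⟩ := hf y
      rw [← map_mul, ← map_mul, Subgroup.mem_center_iff.mp hz g]) hfz
    (by rw [← MonoidHom.map_zpowers]; exact centralType_irrOver_map hM hf) (f a) (f b)
    ⟨k, by rw [← map_pow, hak, map_one]⟩ (fun h => hb (h.trans (orderOf_map_dvd f b)))
  obtain ⟨c, hcdef⟩ : ∃ c, c = a * b * a⁻¹ * b⁻¹ := ⟨_, rfl⟩
  have hc : c ∈ Subgroup.center G := hXc ((hker _).mp (by
    rw [hcdef, map_mul, map_mul, map_mul, hab, map_inv, map_inv]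
    group))
  have hca : c ^ p ^ k = 1 := by
    have hconj : IsConj a⁻¹ (c * a⁻¹) := isConj_iff.mpr ⟨b, by
      rw [← Subgroup.mem_center_iff.mp hc, hcdef]
      group⟩
    have hcomm : Commute c a⁻¹ := (Subgroup.mem_center_iff.mp hc a⁻¹).symm
    have hai : a⁻¹ ^ p ^ k = 1 := by rw [inv_pow, hak, inv_one]
    have := hconj.pow_eq_one hai
    rwa [hcomm.mul_pow, hai, mul_one] at this
  have hc1 : c = 1 :=
    eq_one_of_isConj_mul_of_coprime hc (isConj_iff.mpr ⟨a, by rw [hcdef]; group⟩)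
      (pow_orderOf_eq_one b) hca (hcop.pow_right k)
  rwa [hcdef, mul_inv_eq_one, mul_inv_eq_iff_eq_mul] at hc1

/-! ### Restriction to a subgroup on which the group acts by inner automorphisms -/

section CentralProduct

variable {A G : Type*} [Group A] [Group G] (φ : A →* G)

theorem Representation.IsIrreducible.sum_map_conj_eq [Fintype A] {V : Type*} [AddCommGroup V]
    [Module ℂ V] [FiniteDimensional ℂ V] {ρ : Representation ℂ G V} (hρ : ρ.IsIrreducible)
    (hφ : ∀ g, ∃ y, ∀ a, g * φ a * g⁻¹ = φ (y * a * y⁻¹)) (a : A) :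
    ∑ x, ρ (φ (x * a * x⁻¹)) =
      (Fintype.card A * ρ.character (φ a) / ρ.character 1) • 1 := by
  have := hρ.nontrivial_space
  obtain ⟨c, hc⟩ := hρ.exists_eq_smul_one (∑ x, ρ (φ (x * a * x⁻¹))) fun g => by
    obtain ⟨y, hy⟩ := hφ g
    rw [Finset.sum_mul, Finset.mul_sum]
    refine (Fintype.sum_equiv (Equiv.mulLeft y) _ _ fun x => ?_).symm
    rw [← map_mul, ← map_mul]
    congr 1
    rw [← mul_inv_eq_iff_eq_mul, hy]
    simp [mul_assoc]
  have h := congrArg (LinearMap.trace ℂ V) hc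
  have h1 : ∑ x, LinearMap.trace ℂ V (ρ (φ (x * a * x⁻¹))) =
      Fintype.card A * ρ.character (φ a) := by
    have h2 (x : A) : LinearMap.trace ℂ V (ρ (φ (x * a * x⁻¹))) = ρ.character (φ a) := by
      rw [map_mul φ, map_mul φ, map_inv φ]
      exact ρ.char_conj (φ a) (φ x)
    rw [Finset.sum_congr rfl fun x _ => h2 x]
    simp
  rw [map_sum, h1, map_smul, LinearMap.trace_one, smul_eq_mul] at h
  rw [hc, h, ← Representation.char_one ρ, mul_div_cancel_right₀ _ ρ.character_one_ne_zero]

/-- Two irreducible representations in which the class sums of `A` act by the same scalars have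
proportional characters on `A`. -/
theorem character_mul_eq_of_sum_eq [Fintype A] {V W : Type*} [AddCommGroup V] [Module ℂ V]
    [FiniteDimensional ℂ V] [AddCommGroup W] [Module ℂ W] [FiniteDimensional ℂ W]
    {ρ : Representation ℂ G V} {σ : Representation ℂ A W} (hρ : ρ.IsIrreducible)
    (hσ : σ.IsIrreducible) (hφ : ∀ g, ∃ y, ∀ a, g * φ a * g⁻¹ = φ (y * a * y⁻¹)) (a : A)
    (h : ∀ c d : ℂ, ∑ x, ρ (φ (x * a * x⁻¹)) = c • 1 → ∑ x, σ (x * a * x⁻¹) = d • 1 → c = d) :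
    ρ.character (φ a) * σ.character 1 = ρ.character 1 * σ.character a := by
  have := hρ.nontrivial_space
  have := hσ.nontrivial_space
  have h1 := h _ _ (hρ.sum_map_conj_eq φ hφ a) (hσ.sum_conj_eq a)
  have h2 : (Fintype.card A : ℂ) ≠ 0 := by exact_mod_cast Fintype.card_ne_zero
  rw [mul_div_assoc, mul_div_assoc] at h1
  have h3 := mul_left_cancel₀ h2 h1
  rw [div_eq_div_iff ρ.character_one_ne_zero σ.character_one_ne_zero] at h3
  rw [h3, mul_comm]

theorem exists_mem_Irr_restrict [Finite A] {χ : G → ℂ} (hχ : χ ∈ Irr G)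
    (hφ : ∀ g, ∃ y, ∀ a, g * φ a * g⁻¹ = φ (y * a * y⁻¹)) :
    ∃ θ ∈ Irr A, ∀ a, χ (φ a) * θ 1 = χ 1 * θ a := by
  have := Fintype.ofFinite A
  obtain ⟨n, ρ, hρ, rfl⟩ := hχ
  have := hρ.nontrivial_space
  obtain ⟨U, hU⟩ := Representation.exists_irreducible_subrepresentation
    (MonoidHom.comp ρ φ : Representation ℂ A (Fin n → ℂ))
  have := hU.nontrivial_space
  refine ⟨_, character_mem_Irr hU, fun a =>
    character_mul_eq_of_sum_eq φ hρ hU hφ a fun c d hc hd => ?_⟩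
  -- The two scalars agree because both give the action of one class sum on `u`.
  obtain ⟨u, hu⟩ := exists_ne (0 : U.toSubmodule)
  have h1 := LinearMap.congr_fun hc u
  have h2 := congrArg Subtype.val (LinearMap.congr_fun hd u)
  have h3 : c • (u : Fin n → ℂ) = d • (u : Fin n → ℂ) := by
    refine h1.symm.trans (Eq.trans ?_ h2)
    simp only [LinearMap.sum_apply, Submodule.coe_sum]
    rfl
  exact smul_left_injective ℂ (fun h => hu (Subtype.ext h)) h3

theorem character_mul_of_commute [Finite A] {χ : G → ℂ} (hχ : χ ∈ Irr G)
    (hφ : ∀ g, ∃ y, ∀ a, g * φ a * g⁻¹ = φ (y * a * y⁻¹)) (a : A) (b : G)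
    (hb : ∀ x, Commute (φ x) b) : χ (φ a * b) * χ 1 = χ (φ a) * χ b := by
  have := Fintype.ofFinite A
  obtain ⟨n, ρ, hρ, rfl⟩ := hχ
  have := hρ.nontrivial_space
  -- Multiply the scalar class sum by `ρ b` and take traces: as `b` commutes with the image of `φ`,
  -- every summand contributes `χ(φ(a) b)`.
  have h := congrArg (fun T => LinearMap.trace ℂ _ (T * ρ b)) (hρ.sum_map_conj_eq φ hφ a)
  simp only [Finset.sum_mul, map_sum, smul_mul_assoc, one_mul, map_smul, smul_eq_mul] at h
  have h2 (x : A) : LinearMap.trace ℂ (Fin n → ℂ) (ρ (φ (x * a * x⁻¹)) * ρ b) =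
      ρ.character (φ a * b) := by
    rw [← map_mul, ← ρ.char_conj (φ a * b) (φ x)]
    congr 2
    rw [map_mul, map_mul, map_inv, mul_assoc, mul_assoc (φ x), (hb x).inv_left.eq]
    group
  rw [Finset.sum_congr rfl fun x _ => h2 x] at h
  have h3 : (Fintype.card A : ℂ) ≠ 0 := by exact_mod_cast Fintype.card_ne_zero
  have h4 := ρ.character_one_ne_zero
  change _ = _ * ρ.character b at h
  simp only [Finset.sum_const, Finset.card_univ, nsmul_eq_mul] at h
  field_simp at h
  linear_combination h

end CentralProduct

/-! ### Characters of a direct product -/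

section DirectProduct

variable {A B : Type*} [Group A] [Group B]

open scoped TensorProduct in
theorem exists_mem_Irr_prod [Finite A] [Finite B] {θ : A → ℂ} {ψ : B → ℂ} (hθ : θ ∈ Irr A)
    (hψ : ψ ∈ Irr B) : ∃ χ ∈ Irr (A × B), (∀ a, χ (a, 1) * θ 1 = χ 1 * θ a) ∧
      ∀ b, χ (1, b) * ψ 1 = χ 1 * ψ b := by
  have := Fintype.ofFinite A
  have := Fintype.ofFinite B
  obtain ⟨n, σ, hσ, rfl⟩ := hθ
  obtain ⟨m, τ, hτ, rfl⟩ := hψ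
  have := hσ.nontrivial_space
  have := hτ.nontrivial_space
  let ρ : Representation ℂ (A × B) ((Fin n → ℂ) ⊗[ℂ] (Fin m → ℂ)) :=
    Representation.tprod (MonoidHom.comp σ (MonoidHom.fst A B))
      (MonoidHom.comp τ (MonoidHom.snd A B))
  have hnt : Nontrivial ((Fin n → ℂ) ⊗[ℂ] (Fin m → ℂ)) := by
    refine Module.nontrivial_of_finrank_pos (R := ℂ) ?_
    rw [Module.finrank_tensorProduct]
    exact Nat.mul_pos Module.finrank_pos Module.finrank_pos
  -- Any irreducible constituent of the tensor product suffices: class sums of each factor act on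
  -- the whole tensor product by the scalars of `σ` and `τ`.
  obtain ⟨U, hU⟩ := ρ.exists_irreducible_subrepresentation
  have := hU.nontrivial_space
  obtain ⟨u, hu⟩ := exists_ne (0 : U.toSubmodule)
  have hu' : (u : (Fin n → ℂ) ⊗[ℂ] (Fin m → ℂ)) ≠ 0 := fun h => hu (Subtype.ext h)
  refine ⟨_, character_mem_Irr hU, fun a => ?_, fun b => ?_⟩
  · refine character_mul_eq_of_sum_eq (MonoidHom.inl A B) hU hσ
      (fun g => ⟨g.1, fun a => by ext <;> simp⟩) a fun c d hc hd => ?_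
    have h1 : ∑ x, ρ (x * a * x⁻¹, 1) = d • 1 := by
      have h2 (x : A) : ρ (x * a * x⁻¹, 1) =
          (TensorProduct.map (σ (x * a * x⁻¹)) LinearMap.id) := by
        simp only [ρ, Representation.tprod_apply]
        congr 1
        exact map_one τ
      rw [Finset.sum_congr rfl fun x _ => h2 x]
      change ∑ x, LinearMap.rTensor _ (σ (x * a * x⁻¹)) = _
      rw [← LinearMap.coe_rTensorHom, ← map_sum, hd, map_smul]
      congr 1
      exact LinearMap.rTensor_id _ _
    have h3 := congrArg Subtype.val (LinearMap.congr_fun hc u)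
    have h4 := LinearMap.congr_fun h1 u
    refine smul_left_injective ℂ hu' (h3.symm.trans (Eq.trans ?_ h4))
    simp only [LinearMap.sum_apply, Submodule.coe_sum]
    rfl
  · refine character_mul_eq_of_sum_eq (MonoidHom.inr A B) hU hτ
      (fun g => ⟨g.2, fun a => by ext <;> simp⟩) b fun c d hc hd => ?_
    have h1 : ∑ x, ρ (1, x * b * x⁻¹) = d • 1 := by
      have h2 (x : B) : ρ (1, x * b * x⁻¹) =
          (TensorProduct.map LinearMap.id (τ (x * b * x⁻¹))) := by
        simp only [ρ, Representation.tprod_apply]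
        congr 1
        exact map_one σ
      rw [Finset.sum_congr rfl fun x _ => h2 x]
      change ∑ x, LinearMap.lTensor _ (τ (x * b * x⁻¹)) = _
      rw [← LinearMap.coe_lTensorHom, ← map_sum, hd, map_smul]
      congr 1
      exact LinearMap.lTensor_id _ _
    have h3 := congrArg Subtype.val (LinearMap.congr_fun hc u)
    have h4 := LinearMap.congr_fun h1 u
    refine smul_left_injective ℂ hu' (h3.symm.trans (Eq.trans ?_ h4))
    simp only [LinearMap.sum_apply, Submodule.coe_sum]
    rfl

end DirectProduct

/-! ### Transfer of zeros, kernels and centers between proportional characters -/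

section Ratio

variable {A G : Type*} [Group A] [Group G]

theorem Irr.exists_apply_one_eq {χ : G → ℂ} (hχ : χ ∈ Irr G) : ∃ n : ℕ, n ≠ 0 ∧ χ 1 = n := by
  obtain ⟨n, ρ, hρ, rfl⟩ := hχ
  have := hρ.nontrivial_space
  exact ⟨_, (Module.finrank_pos (R := ℂ)).ne', ρ.char_one⟩

variable {χ : G → ℂ} {θ : A → ℂ} {g : G} {a : A}

theorem eq_zero_iff_of_ratio (hχ : χ ∈ Irr G) (hθ : θ ∈ Irr A) (h : χ g * θ 1 = χ 1 * θ a) :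
    χ g = 0 ↔ θ a = 0 := by
  obtain ⟨n, hn, hn'⟩ := Irr.exists_apply_one_eq hχ
  obtain ⟨m, hm, hm'⟩ := Irr.exists_apply_one_eq hθ
  rw [hn', hm'] at h
  have h1 : (n : ℂ) ≠ 0 := by exact_mod_cast hn
  have h2 : (m : ℂ) ≠ 0 := by exact_mod_cast hm
  constructor <;> intro h0 <;> rw [h0] at h
  · simpa [h1] using h.symm
  · simpa [h2] using h

theorem mem_charKernel_iff_of_ratio (hχ : χ ∈ Irr G) (hθ : θ ∈ Irr A)
    (h : χ g * θ 1 = χ 1 * θ a) : g ∈ charKernel χ ↔ a ∈ charKernel θ := by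
  obtain ⟨n, hn, hn'⟩ := Irr.exists_apply_one_eq hχ
  obtain ⟨m, hm, hm'⟩ := Irr.exists_apply_one_eq hθ
  have h1 : χ 1 ≠ 0 := by rw [hn']; exact_mod_cast hn
  have h2 : θ 1 ≠ 0 := by rw [hm']; exact_mod_cast hm
  change χ g = χ 1 ↔ θ a = θ 1
  constructor <;> intro h0 <;> rw [h0] at h
  · exact (mul_left_cancel₀ h1 h).symm
  · exact mul_right_cancel₀ h2 h

theorem mem_charCenter_iff_norm (hχ : χ ∈ Irr G) : g ∈ charCenter χ ↔ ‖χ g‖ = ‖χ 1‖ := by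
  obtain ⟨n, hn, hn'⟩ := Irr.exists_apply_one_eq hχ
  change ((‖χ g‖ : ℝ) : ℂ) = χ 1 ↔ _
  rw [hn', Complex.norm_natCast]
  norm_cast

theorem mem_charCenter_iff_of_ratio (hχ : χ ∈ Irr G) (hθ : θ ∈ Irr A)
    (h : χ g * θ 1 = χ 1 * θ a) : g ∈ charCenter χ ↔ a ∈ charCenter θ := by
  rw [mem_charCenter_iff_norm hχ, mem_charCenter_iff_norm hθ]
  obtain ⟨n, hn, hn'⟩ := Irr.exists_apply_one_eq hχ
  obtain ⟨m, hm, hm'⟩ := Irr.exists_apply_one_eq hθ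
  have h1 : ‖χ 1‖ ≠ 0 := by rw [hn', Complex.norm_natCast]; exact_mod_cast hn
  have h2 : ‖θ 1‖ ≠ 0 := by rw [hm', Complex.norm_natCast]; exact_mod_cast hm
  have h3 := congrArg norm h
  rw [norm_mul, norm_mul] at h3
  constructor <;> intro h0 <;> rw [h0] at h3
  · exact (mul_left_cancel₀ h1 h3).symm
  · exact mul_right_cancel₀ h2 h3

theorem HasCentralType.of_ratio {f : A → G} (hχ : χ ∈ Irr G) (hθ : θ ∈ Irr A)
    (h : ∀ a, χ (f a) * θ 1 = χ 1 * θ a) (hc : HasCentralType χ) : HasCentralType θ :=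
  fun a ha => (eq_zero_iff_of_ratio hχ hθ (h a)).mp
    (hc _ fun hg => ha ((mem_charCenter_iff_of_ratio hχ hθ (h a)).mp hg))

end Ratio

theorem exists_mem_Irr_notMem_charKernel {G : Type*} [Group G] [Finite G] {g : G} (hg : g ≠ 1) :
    ∃ χ ∈ Irr G, g ∉ charKernel χ := by
  by_contra! hcon
  have h := MonoidAlgebra.eq_zero_of_forall_irreducible
    (MonoidAlgebra.single g (1 : ℂ) - MonoidAlgebra.single 1 1) fun n ρ hρ => by
      have := hρ.nontrivial_space
      rw [map_sub, Representation.asAlgebraHom_single_one, Representation.asAlgebraHom_single_one,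
        ρ.mem_charKernel_iff.mp (hcon _ ⟨n, ρ, hρ, rfl⟩), map_one, sub_self]
  exact hg (MonoidAlgebra.single_left_injective one_ne_zero (sub_eq_zero.mp h))

theorem Irr_nonempty (G : Type*) [Group G] : (Irr G).Nonempty := by
  obtain ⟨U, hU⟩ := (Representation.trivial ℂ G ℂ).exists_irreducible_subrepresentation
  exact ⟨_, character_mem_Irr hU⟩

/-! ### Internal direct products -/

section InternalDirectProduct

variable {G : Type*} [Group G] {S Q : Subgroup G}

theorem IsInternalDirectProduct.commute (h : IsInternalDirectProduct S Q) (s : S) (q : Q) :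
    Commute (s : G) q :=
  Subgroup.commute_of_normal_of_disjoint S Q h.1 h.2.1 (disjoint_iff.mpr h.2.2.1) s q s.2 q.2

theorem IsInternalDirectProduct.exists_eq_mul (h : IsInternalDirectProduct S Q) (g : G) :
    ∃ (s : S) (q : Q), g = s * q := by
  have := h.2.1
  have hg : g ∈ S ⊔ Q := h.2.2.2 ▸ Subgroup.mem_top g
  obtain ⟨s, hs, q, hq, rfl⟩ := Subgroup.mem_sup_of_normal_right.mp hg
  exact ⟨⟨s, hs⟩, ⟨q, hq⟩, rfl⟩

theorem IsInternalDirectProduct.symm (h : IsInternalDirectProduct S Q) :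
    IsInternalDirectProduct Q S :=
  ⟨h.2.1, h.1, by rw [inf_comm, h.2.2.1], by rw [sup_comm, h.2.2.2]⟩

theorem IsInternalDirectProduct.exists_conj_eq (h : IsInternalDirectProduct S Q) (g : G) :
    ∃ y : S, ∀ a : S, g * S.subtype a * g⁻¹ = S.subtype (y * a * y⁻¹) := by
  obtain ⟨s, q, rfl⟩ := h.exists_eq_mul g
  refine ⟨s, fun a => ?_⟩
  have : (q : G) * a = a * q := (h.commute a q).eq.symm
  simp only [Subgroup.subtype_apply, Subgroup.coe_mul, Subgroup.coe_inv]
  rw [mul_assoc (s : G), this]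
  group

/-- The isomorphism `S × Q ≃* G` attached to an internal direct product. -/
noncomputable def IsInternalDirectProduct.mulEquiv (h : IsInternalDirectProduct S Q) :
    S × Q ≃* G :=
  MulEquiv.ofBijective (MonoidHom.noncommCoprod S.subtype Q.subtype fun s q => h.commute s q) (by
    constructor
    · rw [injective_iff_map_eq_one]
      rintro ⟨s, q⟩ hsq
      replace hsq : (s : G) = (q : G)⁻¹ := mul_eq_one_iff_eq_inv.mp hsq
      have hs : (s : G) ∈ S ⊓ Q := ⟨s.2, hsq ▸ Q.inv_mem q.2⟩
      rw [h.2.2.1, Subgroup.mem_bot] at hs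
      rw [hs, eq_comm, inv_eq_one] at hsq
      exact Prod.ext (Subtype.ext hs) (Subtype.ext hsq)
    · intro g
      obtain ⟨s, q, rfl⟩ := h.exists_eq_mul g
      exact ⟨(s, q), rfl⟩)

theorem IsInternalDirectProduct.mulEquiv_apply (h : IsInternalDirectProduct S Q) (x : S × Q) :
    h.mulEquiv x = x.1 * x.2 := rfl

theorem IsInternalDirectProduct.exists_mem_Irr [Finite G] (h : IsInternalDirectProduct S Q)
    {θ : S → ℂ} {ψ : Q → ℂ} (hθ : θ ∈ Irr S) (hψ : ψ ∈ Irr Q) :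
    ∃ χ ∈ Irr G, (∀ s : S, χ s * θ 1 = χ 1 * θ s) ∧ ∀ q : Q, χ q * ψ 1 = χ 1 * ψ q := by
  obtain ⟨χ, hχ, h1, h2⟩ := exists_mem_Irr_prod hθ hψ
  refine ⟨χ ∘ h.mulEquiv.symm.toMonoidHom, comp_mem_Irr hχ h.mulEquiv.symm.surjective,
    fun s => ?_, fun q => ?_⟩
  · have : h.mulEquiv.symm (s : G) = (s, 1) := by
      rw [MulEquiv.symm_apply_eq, h.mulEquiv_apply]; simp
    simpa [this] using h1 s
  · have : h.mulEquiv.symm (q : G) = (1, q) := by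
      rw [MulEquiv.symm_apply_eq, h.mulEquiv_apply]; simp
    simpa [this] using h2 q

theorem IsInternalDirectProduct.card_eq_index [Finite G] (h : IsInternalDirectProduct S Q) :
    Nat.card Q = S.index := by
  have h1 := Nat.card_congr h.mulEquiv.toEquiv
  rw [Nat.card_prod, ← S.card_mul_index] at h1
  exact Nat.eq_of_mul_eq_mul_left Nat.card_pos h1

end InternalDirectProduct

/-! ### Splitting off a Sylow subgroup -/

section Sylow

variable {G : Type*} [Group G] [Finite G] {p : ℕ}

theorem Sylow.normal_and_exists_isInternalDirectProduct [hp : Fact p.Prime] (S : Sylow p G)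
    (hcomm : ∀ a b : G, (∃ k : ℕ, a ^ p ^ k = 1) → ¬ p ∣ orderOf b → a * b = b * a) :
    ∃ Q : Subgroup G, IsInternalDirectProduct (S : Subgroup G) Q := by
  have hcommS : ∀ a ∈ (S : Subgroup G), ∀ b, ¬ p ∣ orderOf b → a * b = b * a :=
    fun a ha b hb => by
      obtain ⟨k, hk⟩ := S.isPGroup' ⟨a, ha⟩
      exact hcomm a b ⟨k, congrArg Subtype.val hk⟩ hb
  have hmem : ∀ b, ¬ p ∣ orderOf b → b ∈ Subgroup.normalizer ((S : Subgroup G) : Set G) := by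
    intro b hb
    rw [Subgroup.mem_normalizer_iff]
    intro x
    have hbi : ¬ p ∣ orderOf b⁻¹ := by rwa [orderOf_inv]
    constructor
    · intro hx
      rwa [← hcommS x hx b hb, mul_inv_cancel_right]
    · intro hx
      have h := hcommS _ hx b hb
      have h2 : x = b * x * b⁻¹ := by
        have h3 : b * x = b * (b * x * b⁻¹) := by rw [← h]; group
        exact mul_left_cancel h3
      rwa [h2]
  have htop : Subgroup.normalizer ((S : Subgroup G) : Set G) = ⊤ := by
    rw [← Subgroup.index_eq_one]
    by_contra hne
    -- No prime `r` divides the index of the normalizer, which contains a Sylow `r`-subgroup: `S`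
    -- itself for `r = p`, and otherwise one that centralizes `S`.
    obtain ⟨r, hr, hdvd⟩ := Nat.exists_prime_and_dvd hne
    have : Fact r.Prime := ⟨hr⟩
    obtain ⟨R, hR⟩ : ∃ R : Sylow r G, (R : Subgroup G) ≤ Subgroup.normalizer ((S : Subgroup G) : Set G) := by
      by_cases hrp : r = p
      · subst hrp
        exact ⟨S, Subgroup.le_normalizer⟩
      · refine ⟨default, fun b hb => hmem b fun hpb => ?_⟩
        obtain ⟨k, hk⟩ := (default : Sylow r G).isPGroup' ⟨b, hb⟩
        have h1 : orderOf b ∣ r ^ k := orderOf_dvd_of_pow_eq_one (congrArg Subtype.val hk)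
        exact hrp ((Nat.prime_dvd_prime_iff_eq hp.out hr).mp
          (hp.out.dvd_of_dvd_pow (hpb.trans h1))).symm
    exact R.not_dvd_index (hdvd.trans (Subgroup.index_dvd_of_le hR))
  have hSn : (S : Subgroup G).Normal := Subgroup.normalizer_eq_top_iff.mp htop
  -- Schur–Zassenhaus; `S` centralizes the complement, which is therefore normal.
  obtain ⟨Q, hQ⟩ := Subgroup.exists_right_complement'_of_coprime S.card_coprime_index
  have hQp : ∀ b ∈ Q, ¬ p ∣ orderOf b := fun b hb h => by
    have h1 : p ∣ Nat.card Q := h.trans (by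
      rw [← Subgroup.orderOf_mk b hb]; exact orderOf_dvd_natCard _)
    rw [← hQ.symm.index_eq_card] at h1
    exact S.not_dvd_index h1
  refine ⟨Q, hSn, ?_, hQ.disjoint.eq_bot, hQ.sup_eq_top⟩
  rw [← Subgroup.normalizer_eq_top_iff, eq_top_iff, ← hQ.sup_eq_top, sup_le_iff]
  refine ⟨fun a ha => ?_, Subgroup.le_normalizer⟩
  rw [Subgroup.mem_normalizer_iff]
  intro x
  constructor
  · intro hx
    rwa [hcommS a ha x (hQp x hx), mul_inv_cancel_right]
  · intro hx
    have h1 := hcommS a⁻¹ (Subgroup.inv_mem _ ha) _ (hQp _ hx)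
    have h2 : x = a * x * a⁻¹ := by
      have h3 : x * a⁻¹ = a * x * a⁻¹ * a⁻¹ := by rw [← h1]; group
      exact mul_right_cancel h3
    rwa [h2]

end Sylow

/-! ### The decomposition theorem and its converse -/

section Main

variable {G : Type*} [Group G] [Finite G] {p : ℕ} {N : Subgroup G}

theorem exists_sylow_inf_ne_bot_of_dvd [hp : Fact p.Prime] (h : p ∣ Nat.card N) :
    ∃ S : Sylow p G, (S : Subgroup G) ⊓ N ≠ ⊥ := by
  obtain ⟨n, hn⟩ := exists_prime_orderOf_dvd_card' p h
  have hP : IsPGroup p (Subgroup.zpowers (n : G)) := IsPGroup.of_card (n := 1) (by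
    rw [Nat.card_zpowers, Subgroup.orderOf_coe, hn, pow_one])
  obtain ⟨S, hS⟩ := hP.exists_le_sylow
  refine ⟨S, fun hbot => ?_⟩
  have h1 : (n : G) ∈ (S : Subgroup G) ⊓ N := ⟨hS (Subgroup.mem_zpowers _), n.2⟩
  rw [hbot, Subgroup.mem_bot] at h1
  rw [← Subgroup.orderOf_coe, h1, orderOf_one] at hn
  exact hp.out.one_lt.ne hn

theorem hasGVZComplementDecomposition_of_centralType [hp : Fact p.Prime] [N.Normal]
    (hN : ∀ χ ∈ IrrOver G N, HasCentralType χ) (S : Sylow p G) (hS : (S : Subgroup G) ⊓ N ≠ ⊥) :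
    HasGVZComplementDecomposition (S : Subgroup G) N := by
  obtain ⟨⟨n, hnS, hnN⟩, hn⟩ := Subgroup.ne_bot_iff_exists_ne_one.mp hS
  have hn1 : n ≠ 1 := fun h => hn (Subtype.ext h)
  have hdvd : p ∣ Nat.card N := by
    obtain ⟨k, hk⟩ := S.isPGroup' ⟨n, hnS⟩
    have hk' : n ^ p ^ k = 1 := congrArg Subtype.val hk
    obtain ⟨j, -, hj⟩ := (Nat.dvd_prime_pow hp.out).mp (orderOf_dvd_of_pow_eq_one hk')
    have hj0 : j ≠ 0 := fun h0 => hn1 (by rwa [h0, pow_zero, orderOf_eq_one_iff] at hj)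
    refine (dvd_pow_self p hj0).trans ?_
    rw [← hj, ← Subgroup.orderOf_mk n hnN]
    exact orderOf_dvd_natCard _
  obtain ⟨z, hzN, hzc, hz⟩ := exists_central_orderOf_eq_prime hN hdvd
  obtain ⟨Q, hQ⟩ := S.normal_and_exists_isInternalDirectProduct
    (commute_of_centralType_over_central _ G rfl z hzc hz
      (centralType_irrOver_mono (Subgroup.zpowers_le.mpr hzN) hN))
  refine ⟨⟨Q, hQ, fun ψ hψ => ?_⟩, fun θ hθ => ?_⟩
  · obtain ⟨θ, hθ, hθn⟩ := exists_mem_Irr_notMem_charKernel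
      (g := (⟨n, hnS⟩ : (S : Subgroup G))) fun h => hn1 (congrArg Subtype.val h)
    obtain ⟨χ, hχ, h1, h2⟩ := hQ.exists_mem_Irr hθ hψ
    exact (hN χ ⟨hχ, fun h => hθn
      ((mem_charKernel_iff_of_ratio hχ hθ (h1 _)).mp (h hnN))⟩).of_ratio hχ hψ h2
  · obtain ⟨ψ, hψ⟩ := Irr_nonempty Q
    obtain ⟨χ, hχ, h1, h2⟩ := hQ.exists_mem_Irr hθ.1 hψ
    exact (hN χ ⟨hχ, fun h => hθ.2 fun s hs =>
      (mem_charKernel_iff_of_ratio hχ hθ.1 (h1 s)).mp (h hs)⟩).of_ratio hχ hθ.1 h1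

/-- Otherwise `N ⊓ K` contains a subgroup of order `p ^ k` for every prime power `p ^ k` dividing
`|N|`, so `|N|` divides its order. -/
theorem exists_sylow_inf_not_le {K : Subgroup G} (h : ¬ N ≤ K) :
    ∃ p : ℕ, p.Prime ∧ ∃ S : Sylow p G, ¬ (S : Subgroup G) ⊓ N ≤ K := by
  by_contra! hcon
  refine h ?_
  have hdvd : Nat.card N ∣ Nat.card (N ⊓ K : Subgroup G) := by
    rw [Nat.dvd_iff_prime_pow_dvd_dvd]
    intro p k hp hpk
    have : Fact p.Prime := ⟨hp⟩
    obtain ⟨P, hP⟩ := Sylow.exists_subgroup_card_pow_prime p hpk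
    have hcard : Nat.card (P.map N.subtype) = p ^ k := by
      rw [Subgroup.card_map_of_injective N.subtype_injective, hP]
    obtain ⟨S, hS⟩ := (IsPGroup.of_card hcard).exists_le_sylow
    have hPN : P.map N.subtype ≤ N := Subgroup.map_subtype_le P
    rw [← hcard]
    exact Subgroup.card_dvd_of_le (le_inf hPN ((le_inf hS hPN).trans (hcon p hp S)))
  have := Subgroup.eq_of_le_of_card_ge (inf_le_left : N ⊓ K ≤ N)
    (Nat.le_of_dvd Nat.card_pos hdvd)
  exact inf_eq_left.mp this

theorem IsInternalDirectProduct.hasCentralType {S Q : Subgroup G}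
    (h : IsInternalDirectProduct S Q) (hQ : IsGVZGroup Q)
    (hS : ∀ θ ∈ IrrOver S (N.subgroupOf S), HasCentralType θ) {χ : G → ℂ} (hχ : χ ∈ Irr G)
    {n : G} (hnS : n ∈ S) (hnN : n ∈ N) (hn : n ∉ charKernel χ) : HasCentralType χ := by
  obtain ⟨θ, hθ, h1⟩ := exists_mem_Irr_restrict S.subtype hχ h.exists_conj_eq
  obtain ⟨ψ, hψ, h2⟩ := exists_mem_Irr_restrict Q.subtype hχ h.symm.exists_conj_eq
  have hθc : HasCentralType θ := hS θ ⟨hθ, fun hsub => hn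
    ((mem_charKernel_iff_of_ratio hχ hθ (h1 ⟨n, hnS⟩)).mpr (hsub hnN))⟩
  have hψc : HasCentralType ψ := hQ ψ hψ
  have hχ1 : χ 1 ≠ 0 := by
    obtain ⟨m, hm, hm'⟩ := Irr.exists_apply_one_eq hχ
    rw [hm']
    exact_mod_cast hm
  intro g hg
  obtain ⟨s, q, rfl⟩ := h.exists_eq_mul g
  have hmul : χ (s * q) * χ 1 = χ s * χ q :=
    character_mul_of_commute S.subtype hχ h.exists_conj_eq s q fun x => h.commute x q
  by_cases hs : s ∈ charCenter θ
  · by_cases hq : q ∈ charCenter ψ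
    · refine absurd ((mem_charCenter_iff_norm hχ).mpr ?_) hg
      have hs' := (mem_charCenter_iff_norm hχ).mp
        ((mem_charCenter_iff_of_ratio hχ hθ (h1 s)).mpr hs)
      have hq' := (mem_charCenter_iff_norm hχ).mp
        ((mem_charCenter_iff_of_ratio hχ hψ (h2 q)).mpr hq)
      have h3 := congrArg norm hmul
      rw [norm_mul, norm_mul] at h3
      simp only [Subgroup.subtype_apply] at hs' hq'
      rw [hs', hq'] at h3
      exact mul_right_cancel₀ (norm_ne_zero_iff.mpr hχ1) h3
    · have h3 : χ q = 0 := (eq_zero_iff_of_ratio hχ hψ (h2 q)).mpr (hψc q hq)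
      rw [h3, mul_zero] at hmul
      exact (mul_eq_zero.mp hmul).resolve_right hχ1
  · have h3 : χ s = 0 := (eq_zero_iff_of_ratio hχ hθ (h1 s)).mpr (hθc s hs)
    rw [h3, zero_mul] at hmul
    exact (mul_eq_zero.mp hmul).resolve_right hχ1

theorem centralType_of_hasGVZComplementDecomposition
    (h : ∀ p : ℕ, p.Prime → ∀ S : Sylow p G, (S : Subgroup G) ⊓ N ≠ ⊥ →
      HasGVZComplementDecomposition (S : Subgroup G) N) :
    ∀ χ ∈ IrrOver G N, HasCentralType χ := by
  rintro χ ⟨hχ, hker⟩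
  obtain ⟨m, ρ, hρ, rfl⟩ := id hχ
  have := hρ.nontrivial_space
  obtain ⟨p, hp, S, hS⟩ := exists_sylow_inf_not_le (K := MonoidHom.ker ρ) fun hle =>
    hker fun n hn => ρ.mem_charKernel_iff.mpr (hle hn)
  obtain ⟨n, ⟨hnS, hnN⟩, hn⟩ := SetLike.not_le_iff_exists.mp hS
  obtain ⟨⟨Q, hQ, hQg⟩, hSc⟩ := h p hp S fun hbot => hS (hbot ▸ bot_le)
  exact hQ.hasCentralType hQg hSc hχ hnS hnN fun h => hn (ρ.mem_charKernel_iff.mp h)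

theorem IsInternalDirectProduct.isHallPComplement [hp : Fact p.Prime] {S : Sylow p G}
    {Q : Subgroup G} (h : IsInternalDirectProduct (S : Subgroup G) Q) :
    IsHallPComplement p Q := by
  refine ⟨by rw [h.card_eq_index]; exact S.not_dvd_index, ?_⟩
  obtain ⟨k, hk⟩ := IsPGroup.iff_card.mp S.isPGroup'
  exact ⟨k, by rw [← h.symm.card_eq_index, hk]⟩

-- The image of `Q'` in `G ⧸ Q` consists of `p'`-elements of a `p`-group, so `Q' ≤ Q`; the index of
-- `Q'` in `Q` then divides both `|Q|` and a power of `p`.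
omit [Finite G] in
theorem IsHallPComplement.eq_of_normal [hp : Fact p.Prime] {Q Q' : Subgroup G} [Q.Normal]
    (h : IsHallPComplement p Q) (h' : IsHallPComplement p Q') : Q' = Q := by
  obtain ⟨k, hk⟩ := h.2
  obtain ⟨l, hl⟩ := h'.2
  have hle : Q' ≤ Q := by
    intro x hx
    rw [← QuotientGroup.eq_one_iff, ← orderOf_eq_one_iff]
    refine Nat.eq_one_of_dvd_coprimes (a := Nat.card Q') (b := p ^ k) ?_ ?_ ?_
    · exact (((Nat.Prime.coprime_iff_not_dvd hp.out).mpr h'.1).pow_left k).symm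
    · refine (orderOf_map_dvd (QuotientGroup.mk' Q) x).trans ?_
      rw [← Subgroup.orderOf_mk x hx]
      exact orderOf_dvd_natCard _
    · rw [← hk]
      exact orderOf_dvd_natCard _
  refine le_antisymm hle (Subgroup.relIndex_eq_one.mp ?_)
  refine Nat.eq_one_of_dvd_coprimes (a := Nat.card Q) (b := p ^ l) ?_ ?_ ?_
  · exact (((Nat.Prime.coprime_iff_not_dvd hp.out).mpr h.1).pow_left l).symm
  · exact Subgroup.relIndex_dvd_card Q' Q
  · rw [← hl]
    exact Subgroup.relIndex_dvd_index_of_le hle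

omit [Finite G] in
theorem eq_of_isPGroup_of_sylow_inf_ne_bot {q : ℕ} (hp : p.Prime) (hq : q.Prime)
    (hN : IsPGroup p N) {S : Sylow q G} (hS : (S : Subgroup G) ⊓ N ≠ ⊥) : q = p := by
  obtain ⟨⟨n, hnS, hnN⟩, hn⟩ := Subgroup.ne_bot_iff_exists_ne_one.mp hS
  by_contra hne
  obtain ⟨k, hk⟩ := S.isPGroup' ⟨n, hnS⟩
  obtain ⟨l, hl⟩ := hN ⟨n, hnN⟩
  refine hn (Subtype.ext (orderOf_eq_one_iff.mp (Nat.eq_one_of_dvd_coprimes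
    (Nat.Coprime.pow k l ((Nat.coprime_primes hq hp).mpr hne))
    (orderOf_dvd_of_pow_eq_one (congrArg Subtype.val hk))
    (orderOf_dvd_of_pow_eq_one (congrArg Subtype.val hl)))))

end Main

theorem mainTheorem2 {G : Type*} [Group G] [Finite G] (N : Subgroup G) (hN : N.Normal) :
    ((∀ χ ∈ IrrOver G N, HasCentralType χ) ↔
      ∀ (p : ℕ), p.Prime → ∀ S : Sylow p G, (S : Subgroup G) ⊓ N ≠ ⊥ →
        HasGVZComplementDecomposition (S : Subgroup G) N) ∧
    (N ≠ ⊥ → (∀ χ ∈ IrrOver G N, HasCentralType χ) →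
      ∃ p : ℕ, p.Prime ∧ ∃ S : Sylow p G, (S : Subgroup G) ⊓ N ≠ ⊥ ∧
        HasGVZComplementDecomposition (S : Subgroup G) N) ∧
    (∀ p : ℕ, p.Prime → IsPGroup p N → N ≠ ⊥ →
      ((∀ χ ∈ IrrOver G N, HasCentralType χ) ↔
        ∃ q : ℕ, q.Prime ∧ ∃ S : Sylow q G, (S : Subgroup G) ⊓ N ≠ ⊥ ∧
          HasGVZComplementDecomposition (S : Subgroup G) N)) ∧
    (∀ p : ℕ, p.Prime → IsPGroup p N → N ≠ ⊥ →
      (∀ χ ∈ IrrOver G N, HasCentralType χ) →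
        (∃! Q : Subgroup G, IsHallPComplement p Q) ∧
          ∀ Q : Subgroup G, IsHallPComplement p Q → Q.Normal ∧ IsGVZGroup Q) := by

  have part2 : N ≠ ⊥ → (∀ χ ∈ IrrOver G N, HasCentralType χ) →
      ∃ p : ℕ, p.Prime ∧ ∃ S : Sylow p G, (S : Subgroup G) ⊓ N ≠ ⊥ ∧
        HasGVZComplementDecomposition (S : Subgroup G) N := by
    intro hbot h
    obtain ⟨p, hp, hdvd⟩ := Nat.exists_prime_and_dvd
      (n := Nat.card N) fun h1 => hbot (Subgroup.card_eq_one.mp h1)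
    have : Fact p.Prime := ⟨hp⟩
    obtain ⟨S, hS⟩ := exists_sylow_inf_ne_bot_of_dvd hdvd
    exact ⟨p, hp, S, hS, hasGVZComplementDecomposition_of_centralType h S hS⟩
  refine ⟨⟨fun h p hp S hS => ?_, centralType_of_hasGVZComplementDecomposition⟩, part2,
    fun p hp hNp hbot => ⟨part2 hbot, ?_⟩, fun p hp hNp hbot h => ?_⟩
  · have : Fact p.Prime := ⟨hp⟩
    exact hasGVZComplementDecomposition_of_centralType h S hS
  · rintro ⟨q, hq, S, hS, hdec⟩
    refine centralType_of_hasGVZComplementDecomposition fun r hr T hT => ?_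
    obtain rfl := eq_of_isPGroup_of_sylow_inf_ne_bot hp hq hNp hS
    obtain rfl := eq_of_isPGroup_of_sylow_inf_ne_bot hp hr hNp hT
    have : Fact r.Prime := ⟨hr⟩
    -- A Sylow subgroup that is a direct factor is normal, hence the only one for its prime, so one
    -- decomposition serves all.
    have hSn : (S : Subgroup G).Normal := hdec.1.choose_spec.1.1
    have := Sylow.unique_of_normal S hSn
    rwa [Subsingleton.elim T S]
  · have : Fact p.Prime := ⟨hp⟩
    obtain ⟨q, hq, S, hS, ⟨Q, hQ, hQg⟩, -⟩ := part2 hbot h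
    obtain rfl := eq_of_isPGroup_of_sylow_inf_ne_bot hp hq hNp hS
    have hQn := hQ.2.1
    have hQh := hQ.isHallPComplement
    refine ⟨⟨Q, hQh, fun Q' hQ' => hQh.eq_of_normal hQ'⟩, fun Q' hQ' => ?_⟩
    rw [hQh.eq_of_normal hQ']
    exact ⟨hQn, hQg⟩
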